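/- **Setting.** Let $D_o\in\mathrm O(n)$, $0<\theta<\alpha<1$, and let $N$ nodes hold data $Y_i=D_oX_i\in\mathbb R^{n\times p_i}$, where all entries of $X_1,\dots,X_N$ are i.i.d. Bernoulli–Gaussian $\mathrm{BG}(\theta)$ (the law of $bg$ with $b\sim\mathrm{Bernoulli}(\theta)$, $g\sim\mathcal N(0,1)$ independent). Put $X=[X_1,\dots,X_N]$, $Y=D_oX$, $p=\sum_ip_i$. For a matrix $M$ with singular value decomposition $M=U\Sigma V^{\mathsf T}$ write $\mathcal P(M)=UV^{\mathsf T}$ (any choice of SVD is allowed), let $\sigma_n(M)$ be the smallest singular value, $M^{\circ3}$ the entrywise cube and $\|M\|_4^4$ the sum of the fourth powers of the entries. MSP starts at some $A^{(0)}\in\mathrm O(n)$ and iterates $A^{(k+1)}=\mathcal P\big(4(A^{(k)}Y)^{\circ3}Y^{\mathsf T}\big)$. DMSP starts at $A_1^{(0)}=\dots=A_N^{(0)}\in\mathrm O(n)$; in iteration $k$ node $i$ forms $G_i^{(k)}=4(A_i^{(k)}Y_i)^{\circ3}Y_i^{\mathsf T}$, the nodes run $T_c^{(k)}$ rounds (a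 number that may depend on the data) of consensus averaging $G_i\leftarrow\sum_jw_{ij}G_j$ over a time-varying, uniformly strongly connected directed network with column-stochastic weights ($w_{ij}>0$ iff $j=i$ or $j$ can send to $i$), and $A_i^{(k+1)}$ is $\mathcal P$ of the result at node $i$. Let $\bar A^{(k+1)}=\mathcal P\big(\frac1N\sum_iG_i^{(k)}\big)$ be the perfect-consensus dictionary, and $$\delta^{(k)}=\max_i\|A^{(k)}-A_i^{(k)}\|_F,\qquad \delta_c^{(k)}=\max_i\|A_i^{(k)}-\bar A^{(k)}\|_F,\qquad \rho^{(k)}=\frac{2\big\|B^{(k)}-\sum_iB_i^{(k)}\big\|_F}{\sigma_n(B^{(k)})+\sigma_n(\sum_iB_i^{(k)})},$$ where $B^{(k)}=(A^{(k)}D_oX)^{\circ3}X^{\mathsf T}$ and $B_i^{(k)}=(A_i^{(k)}D_oX_i)^{\circ3}X_i^{\mathsf T}$. Let $0\le\epsilon<\dfrac{\alpha-\theta}{2\alpha n(1-\theta)+3\sqrt2(1+\alpha)(1-\theta)+\alpha\theta}$ and $C=6\alpha\theta(1-\theta)(1-2n\epsilon)-6(1-\alpha)\theta^2-6\alpha\theta^2\epsilon-18\sqrt2(\alpha+1)\theta(1-\theta)\epsilon$.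 **Theorem (Convergence of DMSP).** For every $N$ and every $\eta>0$ there is a constant $K>0$, depending only on $N$ and $\eta$, such that for all $n,\theta,\alpha,\epsilon,(p_i),D_o$, data, network, runs of MSP and DMSP as above, and every $t\ge0$, there is an event of probability at least $1-\eta$ on which the following implication holds. If 1. there is a signed permutation matrix $P$ with $\|A^{(t)}-PD_o^{\mathsf T}\|_F\le\epsilon$ and $\|A_i^{(t)}-PD_o^{\mathsf T}\|_F\le\epsilon$ for all $i$; 2. $\|A^{(t)}D_o\|_4^4\ge n-\frac12(\epsilon-\delta^{(t)})^2$; 3. $\delta^{(k)}>0$ for all $k\ge t$; 4. for every $k\ge t$ for which the interval $[0,\alpha\delta^{(k)}-\rho^{(k)})$ is non-empty, $\delta_c^{(k+1)}\in[0,\alpha\delta^{(k)}-\rho^{(k)})$; 5. $\dfrac{p}{(\ln p)^4}\ge K\left(\dfrac{(\delta^{(t)}+2)^2n^2\theta}{(\delta^{(t)})^2C^2}+\dfrac{(\delta^{(t)}+2)n^{5/2}}{\delta^{(t)}C}\right)$, then $\delta^{(k+1)}<\alpha\,\delta^{(k)}$ for all $k\ge t$. -/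

import Mathlib

open MeasureTheory ProbabilityTheory
open scoped Matrix Matrix.Norms.Frobenius

namespace DMSP

/-! Matrices.  The norm `‖M‖` of a matrix is the Frobenius norm. -/

/-- The entrywise third power `M^{∘3}`. -/
def cube {I J : Type*} (M : Matrix I J ℝ) : Matrix I J ℝ := M.map (fun x => x ^ 3)

/-- `‖M‖₄⁴`, the sum of the fourth powers of the entries. -/
def l4pow4 {n : ℕ} (M : Matrix (Fin n) (Fin n) ℝ) : ℝ := ∑ i, ∑ j, M i j ^ 4

/-- `σ_n(M)`, the smallest singular value of an `n × n` matrix (Mathlib numbers singular values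
from `0`, in decreasing order). -/
noncomputable def sigmaMin {n : ℕ} (M : Matrix (Fin n) (Fin n) ℝ) : ℝ :=
  (Matrix.toEuclideanLin M).singularValues (n - 1)

/-- `O(n)`. -/
def IsOrth {n : ℕ} (Q : Matrix (Fin n) (Fin n) ℝ) : Prop := Q ∈ Matrix.orthogonalGroup (Fin n) ℝ

/-- Signed permutation matrices. -/
def IsSignedPerm {n : ℕ} (P : Matrix (Fin n) (Fin n) ℝ) : Prop :=
  ∃ (π : Equiv.Perm (Fin n)) (s : Fin n → ℝ),
    (∀ i, s i = 1 ∨ s i = -1) ∧ P = Matrix.diagonal s * π.permMatrix ℝ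

/-- `Q` is an output of the projection step `U Σ Vᵀ ← SVD(M)`, `Q ← U Vᵀ`, for some choice of the
singular value decomposition of `M`. -/
def IsSVDProj {n : ℕ} (M Q : Matrix (Fin n) (Fin n) ℝ) : Prop :=
  ∃ (U V : Matrix (Fin n) (Fin n) ℝ) (s : Fin n → ℝ),
    IsOrth U ∧ IsOrth V ∧ (∀ i, 0 ≤ s i) ∧ M = U * Matrix.diagonal s * Vᵀ ∧ Q = U * Vᵀ

/-- `(A Y)^{∘3} Yᵀ`. -/
def cubeCorr {n : ℕ} {J : Type*} [Fintype J] (A : Matrix (Fin n) (Fin n) ℝ)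
    (Y : Matrix (Fin n) J ℝ) : Matrix (Fin n) (Fin n) ℝ := cube (A * Y) * Yᵀ

/-- The gradient `4 (A Y)^{∘3} Yᵀ` of `A ↦ ‖A Y‖₄⁴`. -/
def grad {n : ℕ} {J : Type*} [Fintype J] (A : Matrix (Fin n) (Fin n) ℝ)
    (Y : Matrix (Fin n) J ℝ) : Matrix (Fin n) (Fin n) ℝ := (4 : ℝ) • cubeCorr A Y

/-- The concatenation `[X_1, …, X_N]`; its columns are indexed by pairs (node, local column). -/
def concat {n N : ℕ} {p : Fin N → ℕ} (X : (i : Fin N) → Matrix (Fin n) (Fin (p i)) ℝ) :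
    Matrix (Fin n) ((i : Fin N) × Fin (p i)) ℝ := Matrix.of fun a q => X q.1 a q.2

/-! The Bernoulli-Gaussian data model. -/

/-- The Bernoulli-Gaussian law `BG(θ)`: the law of `b g` with `b ∼ Bernoulli(θ)` and
`g ∼ N(0,1)` independent. -/
noncomputable def bernoulliGaussian (θ : ℝ) : Measure ℝ :=
  ENNReal.ofReal (1 - θ) • Measure.dirac 0 + ENNReal.ofReal θ • gaussianReal 0 1

/-- All entries of all the local matrices `X_i` are i.i.d. with law `BG(θ)`. -/
structure IsBGData {n N : ℕ} {p : Fin N → ℕ} {Ω : Type*} [MeasurableSpace Ω] (μ : Measure Ω)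
    (θ : ℝ) (X : (i : Fin N) → Ω → Matrix (Fin n) (Fin (p i)) ℝ) : Prop where
  measurable : ∀ i a j, Measurable fun ω => X i ω a j
  law : ∀ i a j, μ.map (fun ω => X i ω a j) = bernoulliGaussian θ
  indep : iIndepFun
    (fun (q : (i : Fin N) × (Fin n × Fin (p i))) (ω : Ω) => X q.1 ω q.2.1 q.2.2) μ

/-! The network.  `E t s i j` says that at inner iteration `s` of outer iteration `t` node `i` can
send messages to node `j`. -/

/-- For some window length `B > 0`, the union of the edge sets over each window
`[kB, (k+1)B)` of inner iterations is strongly connected. -/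
def UniformlyStronglyConnected {N : ℕ} (E : ℕ → ℕ → Fin N → Fin N → Prop) : Prop :=
  ∃ B : ℕ, 0 < B ∧ ∀ t k : ℕ, 0 < t → 0 < k → ∀ i j : Fin N,
    Relation.ReflTransGen
      (fun a b => ∃ s, k * B ≤ s ∧ s < (k + 1) * B ∧ E t s a b) i j

/-- The weighted adjacency matrices: column stochastic, and `w_{ij} > 0` exactly when `j` is an
in-neighbour of `i` (every node being an in-neighbour of itself). -/
structure IsWeights {N : ℕ} (E : ℕ → ℕ → Fin N → Fin N → Prop)
    (W : ℕ → ℕ → Matrix (Fin N) (Fin N) ℝ) : Prop where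
  nonneg : ∀ t s i j, 0 ≤ W t s i j
  col_sum : ∀ t s j, ∑ i, W t s i j = 1
  pos_iff : ∀ t s i j, 0 < W t s i j ↔ (E t s j i ∨ j = i)

/-- Consensus averaging with the weights of one outer iteration: the matrices held by the nodes
after `s` rounds, started from `G`. -/
def consensus {n N : ℕ} (W : ℕ → Matrix (Fin N) (Fin N) ℝ)
    (G : Fin N → Matrix (Fin n) (Fin n) ℝ) : ℕ → Fin N → Matrix (Fin n) (Fin n) ℝ
  | 0 => G
  | s + 1 => fun i => ∑ j, W (s + 1) i j • consensus W G s j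

/-! The two algorithms. -/

/-- `A` is a run of MSP on the data `Y`. -/
structure IsMSP {n : ℕ} {J : Type*} [Fintype J] (Y : Matrix (Fin n) J ℝ)
    (A : ℕ → Matrix (Fin n) (Fin n) ℝ) : Prop where
  init : IsOrth (A 0)
  step : ∀ t, IsSVDProj (grad (A t) Y) (A (t + 1))

/-- `A` (`A t i` is the dictionary of node `i` at time `t`) is a run of DMSP on the local data `Y`,
with weights `W` and with `Tc t` rounds of consensus averaging in outer iteration `t`. -/
structure IsDMSP {n N : ℕ} {p : Fin N → ℕ} (W : ℕ → ℕ → Matrix (Fin N) (Fin N) ℝ) (Tc : ℕ → ℕ)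
    (Y : (i : Fin N) → Matrix (Fin n) (Fin (p i)) ℝ)
    (A : ℕ → Fin N → Matrix (Fin n) (Fin n) ℝ) : Prop where
  init : ∀ i, IsOrth (A 0 i)
  init_eq : ∀ i j, A 0 i = A 0 j
  step : ∀ t i,
    IsSVDProj (consensus (W t) (fun j => grad (A t j) (Y j)) (Tc t) i) (A (t + 1) i)

/-- `Abar (t+1)` is the dictionary that DMSP would produce in outer iteration `t` from the local
dictionaries `A t i` if consensus averaging returned the exact average of the local gradients. -/
def IsPerfectConsensus {n N : ℕ} {p : Fin N → ℕ}
    (Y : (i : Fin N) → Matrix (Fin n) (Fin (p i)) ℝ)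
    (A : ℕ → Fin N → Matrix (Fin n) (Fin n) ℝ) (Abar : ℕ → Matrix (Fin n) (Fin n) ℝ) : Prop :=
  ∀ t, IsSVDProj ((N : ℝ)⁻¹ • ∑ i, grad (A t i) (Y i)) (Abar (t + 1))

/-! The quantities of the convergence analysis. -/

/-- `max_i ‖A_i - M‖_F`.  With `M` the MSP iterate this is `δ`; with `M` the perfect-consensus
dictionary it is `δ_c`. -/
noncomputable def maxDev {n N : ℕ} (M : Matrix (Fin n) (Fin n) ℝ)
    (A : Fin N → Matrix (Fin n) (Fin n) ℝ) : ℝ := ⨆ i, ‖A i - M‖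

/-- `2 ‖B - ∑ B_i‖_F / (σ_n(B) + σ_n(∑ B_i))` with `B = (U X)^{∘3} Xᵀ`, `U = A D`, and
`B_i = (U_i X_i)^{∘3} X_iᵀ`, `U_i = A_i D`. -/
noncomputable def pert {n N : ℕ} {p : Fin N → ℕ} (D : Matrix (Fin n) (Fin n) ℝ)
    (X : (i : Fin N) → Matrix (Fin n) (Fin (p i)) ℝ) (A : Matrix (Fin n) (Fin n) ℝ)
    (Ai : Fin N → Matrix (Fin n) (Fin n) ℝ) : ℝ :=
  2 * ‖cubeCorr (A * D) (concat X) - ∑ i, cubeCorr (Ai i * D) (X i)‖ /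
    (sigmaMin (cubeCorr (A * D) (concat X)) + sigmaMin (∑ i, cubeCorr (Ai i * D) (X i)))

/-- The upper end of the range allowed for `ε`. -/
noncomputable def epsMax (n : ℕ) (θ α : ℝ) : ℝ :=
  (α - θ) / (2 * α * n * (1 - θ) + 3 * √2 * (1 + α) * (1 - θ) + α * θ)

/-- The constant `C`. -/
noncomputable def Cconst (n : ℕ) (θ α ε : ℝ) : ℝ :=
  6 * α * θ * (1 - θ) * (1 - 2 * n * ε) - 6 * (1 - α) * θ ^ 2 - 6 * α * θ ^ 2 * ε
    - 18 * √2 * (α + 1) * θ * (1 - θ) * ε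

/-- The sample-size scale `(δ+2)² n² θ / (δ² C²) + (δ+2) n^{5/2} / (δ C)`. -/
noncomputable def sampleScale (n : ℕ) (θ C δ : ℝ) : ℝ :=
  (δ + 2) ^ 2 * (n : ℝ) ^ 2 * θ / (δ ^ 2 * C ^ 2) +
    (δ + 2) * (n : ℝ) ^ (5 / 2 : ℝ) / (δ * C)

end DMSP

/-! Write `U = A * D` and `U_i = A_i * D`. Orthogonal polar factors are equivariant under
multiplication by orthogonal matrices, so `D` disappears: MSP sends `U` to a polar factor of
`cubeCorr U X`, and perfect consensus gives one of `∑ cubeCorr U_i X_i`. The entrywise cube commutes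
with signed permutations, so estimates near `P` reduce to estimates near `1`.

Contraction. The perturbation bound `IsSVDProj.norm_sub_le` says exactly that the next MSP iterate
and the perfect-consensus dictionary differ by at most `ρ`. Hence the next `δ` is at most `ρ + δ_c`,
which is below `α δ` once `ρ < α δ`. Per column, the mean of `cubeCorr U` is `meanCorr θ U`: it
equals `3θ P` at `P` and is Lipschitz with constant `L = lipConst θ r` on the `r`-ball of orthogonal
matrices around `P`. Without sampling noise this gives `ρ ≤ L δ / (3θ - L r)`, and `Cconst` at `r`
is a lower bound for the gap that makes this less than `α δ` (`Cconst_le_gap`, `pert_lt`).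

Noise. The difference between `cubeCorr U X` and its mean is the contraction of the cubes of the
rows of `U` with a tensor `dev` of centred empirical fourth moments, which does not involve `U`. A
single event on which this tensor is small therefore serves all dictionaries and all iterations,
however the runs depend on the data. Since the constant may depend on `η`, second moments and
Markov's inequality suffice (`exists_event`).

Invariance. The fourth-power hypothesis puts the MSP iterate within `ε - δ` of `P`. A slightly
larger ball is preserved by MSP (`norm_msp_step_le`, `msp_gap`), and the decrease of `δ` keeps the
local dictionaries near `P`; both facts are carried by one induction. -/

namespace DMSP

/-! ### Frobenius norm and trace pairing -/

section Frobenius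

variable {I J : Type*} [Fintype I] [Fintype J]

lemma norm_sq_eq_sum (M : Matrix I J ℝ) : ‖M‖ ^ 2 = ∑ i, ∑ j, M i j ^ 2 := by
  rw [Matrix.frobenius_norm_def, ← Real.sqrt_eq_rpow, Real.sq_sqrt (by positivity)]
  simp

lemma norm_sq_eq_trace (M : Matrix I J ℝ) : ‖M‖ ^ 2 = (Mᵀ * M).trace := by
  rw [norm_sq_eq_sum, Finset.sum_comm]
  simp [Matrix.trace, Matrix.mul_apply, sq]

lemma trace_transpose_mul_le (M M' : Matrix I J ℝ) : (Mᵀ * M').trace ≤ ‖M‖ * ‖M'‖ := by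
  have h : (Mᵀ * M').trace = ∑ q : J × I, M q.2 q.1 * M' q.2 q.1 := by
    rw [Fintype.sum_prod_type]
    simp [Matrix.trace, Matrix.mul_apply]
  have h' : ∀ M : Matrix I J ℝ, ‖M‖ = √(∑ q : J × I, M q.2 q.1 ^ 2) := by
    intro M
    rw [Fintype.sum_prod_type, Finset.sum_comm]
    change ‖M‖ = √(∑ i, ∑ j, M i j ^ 2)
    rw [← norm_sq_eq_sum, Real.sqrt_sq (norm_nonneg _)]
  rw [h, h', h']
  exact Real.sum_mul_le_sqrt_mul_sqrt _ _ _

end Frobenius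

/-! ### Orthogonal matrices, singular values and polar factors -/

section Matrices

variable {n : ℕ}

lemma IsOrth.mul_transpose {Q : Matrix (Fin n) (Fin n) ℝ} (hQ : IsOrth Q) : Q * Qᵀ = 1 :=
  (Matrix.mem_orthogonalGroup_iff _ _).1 hQ

lemma IsOrth.transpose_mul {Q : Matrix (Fin n) (Fin n) ℝ} (hQ : IsOrth Q) : Qᵀ * Q = 1 :=
  (Matrix.mem_orthogonalGroup_iff' _ _).1 hQ

lemma IsOrth.transpose {Q : Matrix (Fin n) (Fin n) ℝ} (hQ : IsOrth Q) : IsOrth Qᵀ :=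
  (Matrix.mem_orthogonalGroup_iff _ _).2 (by rw [Matrix.transpose_transpose, hQ.transpose_mul])

lemma IsOrth.mul {Q R : Matrix (Fin n) (Fin n) ℝ} (hQ : IsOrth Q) (hR : IsOrth R) :
    IsOrth (Q * R) := mul_mem hQ hR

lemma isOrth_one : IsOrth (1 : Matrix (Fin n) (Fin n) ℝ) := one_mem _

lemma norm_mul_orth {I : Type*} [Fintype I] (M : Matrix I (Fin n) ℝ)
    {Q : Matrix (Fin n) (Fin n) ℝ} (hQ : IsOrth Q) : ‖M * Q‖ = ‖M‖ := by
  rw [← sq_eq_sq₀ (norm_nonneg _) (norm_nonneg _), norm_sq_eq_trace, norm_sq_eq_trace,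
    Matrix.transpose_mul, Matrix.mul_assoc, Matrix.trace_mul_comm, Matrix.mul_assoc,
    Matrix.mul_assoc, hQ.mul_transpose, Matrix.mul_one]

lemma norm_orth_mul {J : Type*} [Fintype J] (M : Matrix (Fin n) J ℝ)
    {Q : Matrix (Fin n) (Fin n) ℝ} (hQ : IsOrth Q) : ‖Q * M‖ = ‖M‖ := by
  rw [← sq_eq_sq₀ (norm_nonneg _) (norm_nonneg _), norm_sq_eq_trace, norm_sq_eq_trace,
    Matrix.transpose_mul, Matrix.mul_assoc, ← Matrix.mul_assoc _ Q M, hQ.transpose_mul,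
    Matrix.one_mul]

lemma IsOrth.row_sq_sum {Q : Matrix (Fin n) (Fin n) ℝ} (hQ : IsOrth Q) (i : Fin n) :
    ∑ j, Q i j ^ 2 = 1 := by
  have h := congrFun (congrFun hQ.mul_transpose i) i
  simpa [Matrix.mul_apply, sq] using h

lemma norm_toEuclideanLin_le (M : Matrix (Fin n) (Fin n) ℝ) (v : EuclideanSpace ℝ (Fin n)) :
    ‖Matrix.toEuclideanLin M v‖ ≤ ‖M‖ * ‖v‖ := by
  refine abs_le_of_sq_le_sq' ?_ (by positivity) |>.2
  rw [mul_pow, EuclideanSpace.norm_sq_eq, EuclideanSpace.norm_sq_eq, norm_sq_eq_sum,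
    Finset.sum_mul]
  refine Finset.sum_le_sum fun i _ => ?_
  simp only [Matrix.ofLp_toLpLin, Matrix.toLin'_apply, Matrix.mulVec, dotProduct, Real.norm_eq_abs,
    sq_abs]
  exact Finset.sum_mul_sq_le_sq_mul_sq _ _ _

lemma inner_toEuclideanLin (M : Matrix (Fin n) (Fin n) ℝ) (v : EuclideanSpace ℝ (Fin n)) :
    ‖Matrix.toEuclideanLin M v‖ ^ 2 =
      inner ℝ ((LinearMap.adjoint (Matrix.toEuclideanLin M) ∘ₗ Matrix.toEuclideanLin M) v) v := by
  rw [LinearMap.comp_apply, LinearMap.adjoint_inner_left, real_inner_self_eq_norm_sq]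

lemma norm_toEuclideanLin_orth {Q : Matrix (Fin n) (Fin n) ℝ} (hQ : IsOrth Q)
    (v : EuclideanSpace ℝ (Fin n)) : ‖Matrix.toEuclideanLin Q v‖ = ‖v‖ := by
  rw [← sq_eq_sq₀ (norm_nonneg _) (norm_nonneg _), inner_toEuclideanLin,
    ← Matrix.toEuclideanLin_conjTranspose_eq_adjoint, LinearMap.comp_apply]
  have : Matrix.toEuclideanLin Qᴴ (Matrix.toEuclideanLin Q v) = v := by
    ext i
    simp [Matrix.mulVec_mulVec, hQ.transpose_mul]
  rw [this, real_inner_self_eq_norm_sq]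

lemma le_sigmaMin (hn : 0 < n) {M : Matrix (Fin n) (Fin n) ℝ} {c : ℝ}
    (h : ∀ v, c * ‖v‖ ≤ ‖Matrix.toEuclideanLin M v‖) : c ≤ sigmaMin M := by
  rcases le_total c 0 with hc | hc
  · exact hc.trans (LinearMap.singularValues_nonneg _ _)
  have hev := (Matrix.toEuclideanLin M).hasEigenvalue_adjoint_comp_self_sq_singularValues
    (n := n - 1) (by simp; omega)
  obtain ⟨v, hv⟩ := hev.exists_hasEigenvector
  have hv0 : 0 < ‖v‖ := norm_pos_iff.2 hv.2
  have h1 := inner_toEuclideanLin M v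
  rw [hv.apply_eq_smul, real_inner_smul_left, real_inner_self_eq_norm_sq, ← mul_pow] at h1
  have h2 := h v
  have h3 := (sq_eq_sq₀ (norm_nonneg _)
    (mul_nonneg (LinearMap.singularValues_nonneg _ _) hv0.le)).1 h1
  rw [h3] at h2
  exact le_of_mul_le_mul_right h2 hv0

lemma sub_le_sigmaMin (hn : 0 < n) {M Q : Matrix (Fin n) (Fin n) ℝ} (hQ : IsOrth Q) {c e : ℝ}
    (hc : 0 ≤ c) (h : ‖M - c • Q‖ ≤ e) : c - e ≤ sigmaMin M := by
  refine le_sigmaMin hn fun v => ?_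
  have h1 : Matrix.toEuclideanLin M v
      = c • Matrix.toEuclideanLin Q v + Matrix.toEuclideanLin (M - c • Q) v := by
    simp [map_sub]
  have h2 := norm_toEuclideanLin_le (M - c • Q) v
  have h3 := norm_sub_norm_le (c • Matrix.toEuclideanLin Q v)
    (-Matrix.toEuclideanLin (M - c • Q) v)
  rw [norm_smul, norm_toEuclideanLin_orth hQ, norm_neg, sub_neg_eq_add, ← h1,
    Real.norm_of_nonneg hc] at h3
  have h4 := mul_le_mul_of_nonneg_right h (norm_nonneg v)
  linarith

/-- Column `i` of `V` is an eigenvector of `Mᵀ * M` with eigenvalue `s i ^ 2`, so `s i` occurs among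
the ordered singular values, whose last index is `n - 1`. The values `s` need not be sorted, which
is why every choice of decomposition is covered. -/
lemma sigmaMin_le (U V : Matrix (Fin n) (Fin n) ℝ) (s : Fin n → ℝ) (hU : IsOrth U)
    (hV : IsOrth V) (hs : ∀ i, 0 ≤ s i) (i : Fin n) :
    sigmaMin (U * Matrix.diagonal s * Vᵀ) ≤ s i := by
  set M := U * Matrix.diagonal s * Vᵀ with hM
  set T := Matrix.toEuclideanLin M with hT
  have hfin : Module.finrank ℝ (EuclideanSpace ℝ (Fin n)) = n := by simp
  have hMM : Mᵀ * M * V = V * Matrix.diagonal (fun j => s j ^ 2) := by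
    have : Mᵀ * M * V
        = V * Matrix.diagonal s * (Uᵀ * U) * Matrix.diagonal s * (Vᵀ * V) := by
      simp only [hM, Matrix.transpose_mul, Matrix.transpose_transpose,
        Matrix.diagonal_transpose, Matrix.mul_assoc]
    rw [this, hU.transpose_mul, hV.transpose_mul, Matrix.mul_one, Matrix.mul_one,
      Matrix.mul_assoc, Matrix.diagonal_mul_diagonal]
    simp only [sq]
  let w : EuclideanSpace ℝ (Fin n) := WithLp.toLp 2 (fun j => V j i)
  have hw : (LinearMap.adjoint T ∘ₗ T) w = (s i ^ 2) • w := by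
    rw [hT, ← Matrix.toEuclideanLin_conjTranspose_eq_adjoint, LinearMap.comp_apply]
    ext j
    have h := congrFun (congrFun hMM j) i
    rw [Matrix.mul_diagonal, Matrix.mul_apply] at h
    simp only [Matrix.conjTranspose_eq_transpose_of_trivial, Matrix.ofLp_toLpLin,
      Matrix.toLin'_apply, Matrix.mulVec_mulVec, PiLp.smul_apply, smul_eq_mul]
    rw [mul_comm]
    exact h
  have hw0 : w ≠ 0 := by
    intro h0
    have h := congrFun (congrFun hV.transpose_mul i) i
    rw [Matrix.mul_apply, Matrix.one_apply_eq] at h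
    have h1 : ∀ j, V j i = 0 := fun j => congrArg (fun x : EuclideanSpace ℝ (Fin n) => x j) h0
    simp [h1] at h
  have hev : Module.End.HasEigenvalue (LinearMap.adjoint T ∘ₗ T) (s i ^ 2) :=
    Module.End.hasEigenvalue_of_hasEigenvector
      (Module.End.hasEigenvector_iff.2 ⟨Module.End.mem_eigenspace_iff.2 hw, hw0⟩)
  obtain ⟨j, hj⟩ := T.isSymmetric_adjoint_comp_self.exists_eigenvalues_eq hfin hev
  have hj' : T.singularValues j ^ 2 = s i ^ 2 := by
    rw [T.sq_singularValues_fin hfin]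
    exact_mod_cast hj
  have h1 : T.singularValues (n - 1) ≤ T.singularValues j :=
    T.singularValues_antitone (by omega)
  have h2 := (sq_eq_sq₀ (T.singularValues_nonneg _) (hs i)).1 hj'
  exact h1.trans h2.le

/-- For `Q` an orthogonal polar factor of `M` and `R` orthogonal,
`⟨M, Q - R⟩ ≥ ½ σ_min(M) ‖Q - R‖²`. -/
lemma IsSVDProj.le_trace {M Q R : Matrix (Fin n) (Fin n) ℝ} (h : IsSVDProj M Q)
    (hR : IsOrth R) : sigmaMin M * ‖Q - R‖ ^ 2 ≤ 2 * (Mᵀ * (Q - R)).trace := by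
  obtain ⟨U, V, s, hU, hV, hs, rfl, rfl⟩ := h
  have hσ := sigmaMin_le U V s hU hV hs
  set σ := sigmaMin (U * Matrix.diagonal s * Vᵀ)
  have hQV : (U * Vᵀ - R) * V = U - R * V := by
    rw [Matrix.sub_mul, Matrix.mul_assoc, hV.transpose_mul, Matrix.mul_one]
  have hRV : IsOrth (R * V) := hR.mul hV
  rw [← norm_mul_orth _ hV, hQV]
  set Z := R * V with hZ
  have hcol : ∀ {Q : Matrix (Fin n) (Fin n) ℝ}, IsOrth Q → ∀ j, ∑ i, Q i j ^ 2 = 1 :=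
    fun hQ j => by simpa using hQ.transpose.row_sq_sum j
  have htr : ((U * Matrix.diagonal s * Vᵀ)ᵀ * (U * Vᵀ - R)).trace
      = ∑ j, s j * ∑ i, U i j * (U i j - Z i j) := by
    have : (U * Matrix.diagonal s * Vᵀ)ᵀ * (U * Vᵀ - R)
        = V * (Matrix.diagonal s * (Uᵀ * (U * Vᵀ - R))) := by
      simp only [Matrix.transpose_mul, Matrix.transpose_transpose,
        Matrix.diagonal_transpose, Matrix.mul_assoc]
    rw [this, Matrix.trace_mul_comm, Matrix.mul_assoc, Matrix.mul_assoc, hQV]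
    refine Finset.sum_congr rfl fun j _ => ?_
    rw [Matrix.diag_apply, Matrix.diagonal_mul, Matrix.mul_apply]
    rfl
  rw [htr, norm_sq_eq_sum, Finset.sum_comm, Finset.mul_sum, Finset.mul_sum]
  refine Finset.sum_le_sum fun j _ => ?_
  -- Columns of `U` and `Z` are unit vectors, so `‖u - z‖² = 2⟨u, u - z⟩`. The trace is therefore
  -- the sum of `s j / 2` times squared column distances.
  have e : 2 * (∑ i, U i j * (U i j - Z i j)) = ∑ i, (U - Z) i j ^ 2 := by
    have h1 : ∑ i, (U - Z) i j ^ 2 =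
        2 * (∑ i, U i j * (U i j - Z i j)) + ∑ i, Z i j ^ 2 - ∑ i, U i j ^ 2 := by
      rw [Finset.mul_sum, ← Finset.sum_add_distrib, ← Finset.sum_sub_distrib]
      refine Finset.sum_congr rfl fun i _ => ?_
      rw [Matrix.sub_apply]
      ring
    rw [h1, hcol hU, hcol hRV]
    ring
  calc σ * ∑ i, (U - Z) i j ^ 2 ≤ s j * ∑ i, (U - Z) i j ^ 2 :=
        mul_le_mul_of_nonneg_right (hσ j) (Finset.sum_nonneg fun i _ => sq_nonneg _)
    _ = _ := by rw [← e]; ring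

lemma IsSVDProj.isOrth {M Q : Matrix (Fin n) (Fin n) ℝ} (h : IsSVDProj M Q) : IsOrth Q := by
  obtain ⟨U, V, s, hU, hV, -, -, rfl⟩ := h
  exact hU.mul hV.transpose

/-- The perturbation bound for orthogonal polar factors in the Frobenius norm. -/
lemma IsSVDProj.norm_sub_le {M₁ M₂ Q₁ Q₂ : Matrix (Fin n) (Fin n) ℝ} (h₁ : IsSVDProj M₁ Q₁)
    (h₂ : IsSVDProj M₂ Q₂) :
    (sigmaMin M₁ + sigmaMin M₂) * ‖Q₁ - Q₂‖ ≤ 2 * ‖M₁ - M₂‖ := by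
  -- Add the two trace inequalities with the roles exchanged, apply Cauchy-Schwarz to `M₁ - M₂` and
  -- `Q₁ - Q₂`, and cancel one factor `‖Q₁ - Q₂‖`.
  have e₁ := h₁.le_trace h₂.isOrth
  have e₂ := h₂.le_trace h₁.isOrth
  have e₃ := trace_transpose_mul_le (M₁ - M₂) (Q₁ - Q₂)
  rw [Matrix.transpose_sub, Matrix.sub_mul, Matrix.trace_sub] at e₃
  rw [← neg_sub Q₁ Q₂, Matrix.mul_neg, Matrix.trace_neg, norm_neg] at e₂
  rcases (norm_nonneg (Q₁ - Q₂)).eq_or_lt with h0 | h0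
  · rw [← h0]; simp
  · refine le_of_mul_le_mul_right ?_ h0
    nlinarith

lemma IsSVDProj.of_smul {M Q : Matrix (Fin n) (Fin n) ℝ} {c : ℝ} (hc : 0 < c)
    (h : IsSVDProj (c • M) Q) : IsSVDProj M Q := by
  obtain ⟨U, V, s, hU, hV, hs, hM, hQ⟩ := h
  refine ⟨U, V, fun i => c⁻¹ * s i, hU, hV, fun i => by have := hs i; positivity, ?_, hQ⟩
  have hd : Matrix.diagonal (fun i => c⁻¹ * s i) = c⁻¹ • Matrix.diagonal s := by
    rw [← Matrix.diagonal_smul]; rfl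
  rw [hd, Matrix.mul_smul, Matrix.smul_mul, ← hM, smul_smul, inv_mul_cancel₀ hc.ne', one_smul]

lemma IsSVDProj.orth_mul_mul_orth {M Q R S : Matrix (Fin n) (Fin n) ℝ} (h : IsSVDProj M Q)
    (hR : IsOrth R) (hS : IsOrth S) : IsSVDProj (R * M * S) (R * Q * S) := by
  obtain ⟨U, V, s, hU, hV, hs, rfl, rfl⟩ := h
  refine ⟨R * U, Sᵀ * V, s, hR.mul hU, hS.transpose.mul hV, hs, ?_, ?_⟩ <;>
    simp only [Matrix.transpose_mul, Matrix.transpose_transpose, Matrix.mul_assoc]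

lemma isSVDProj_smul_one {c : ℝ} (hc : 0 ≤ c) :
    IsSVDProj (c • (1 : Matrix (Fin n) (Fin n) ℝ)) 1 :=
  ⟨1, 1, fun _ => c, isOrth_one, isOrth_one, fun _ => hc, by simp [Matrix.smul_one_eq_diagonal],
    by simp⟩


/-! ### The cube map and the mean correlation near the identity -/

lemma IsOrth.row_sub_one_sq {U : Matrix (Fin n) (Fin n) ℝ} (hU : IsOrth U) (i : Fin n) :
    ∑ j, (U - 1) i j ^ 2 = 2 * (1 - U i i) := by
  have h : ∀ j, (U - 1) i j ^ 2
      = U i j ^ 2 + (if i = j then 1 - 2 * U i j else 0) := by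
    intro j
    rw [Matrix.sub_apply, Matrix.one_apply]
    split_ifs <;> ring
  simp only [h, Finset.sum_add_distrib, hU.row_sq_sum, Finset.sum_ite_eq, Finset.mem_univ,
    if_true]
  ring

lemma row_sq_le {I J : Type*} [Fintype I] [Fintype J] {M : Matrix I J ℝ} {r : ℝ} (h : ‖M‖ ≤ r)
    (i : I) : ∑ j, M i j ^ 2 ≤ r ^ 2 := by
  have h1 := norm_sq_eq_sum M
  have h2 : ∑ j, M i j ^ 2 ≤ ∑ i, ∑ j, M i j ^ 2 :=
    Finset.single_le_sum (f := fun i => ∑ j, M i j ^ 2)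
      (fun i _ => Finset.sum_nonneg fun j _ => sq_nonneg _) (Finset.mem_univ i)
  have h3 := pow_le_pow_left₀ (norm_nonneg M) h 2
  linarith

lemma entry_sq_le {I J : Type*} [Fintype I] [Fintype J] {M : Matrix I J ℝ} {r : ℝ}
    (h : ‖M‖ ≤ r) (i : I) (j : J) : M i j ^ 2 ≤ r ^ 2 :=
  (Finset.single_le_sum (f := fun j => M i j ^ 2) (fun _ _ => sq_nonneg _)
    (Finset.mem_univ j)).trans (row_sq_le h i)

/-- Orthogonality makes the diagonal second order: `2 (1 - U i i)` is the squared length of row `i`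
of `U - 1`. A difference of two such squares factors, which gains the factor `r`. -/
lemma IsOrth.diag_sub_sq_le {U V : Matrix (Fin n) (Fin n) ℝ} (hU : IsOrth U) (hV : IsOrth V)
    {r : ℝ} (hUr : ‖U - 1‖ ≤ r) (hVr : ‖V - 1‖ ≤ r) (i : Fin n) :
    (U i i - V i i) ^ 2 ≤ r ^ 2 * ∑ j, (U - V) i j ^ 2 := by
  have h1 : 2 * (V i i - U i i) = ∑ j, (U - V) i j * ((U - 1) i j + (V - 1) i j) := by
    have : ∑ j, (U - V) i j * ((U - 1) i j + (V - 1) i j)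
        = ∑ j, (U - 1) i j ^ 2 - ∑ j, (V - 1) i j ^ 2 := by
      rw [← Finset.sum_sub_distrib]
      refine Finset.sum_congr rfl fun j _ => ?_
      simp only [Matrix.sub_apply]
      ring
    rw [this, hU.row_sub_one_sq, hV.row_sub_one_sq]
    ring
  have h2 := Finset.sum_mul_sq_le_sq_mul_sq Finset.univ (fun j => (U - V) i j)
    (fun j => (U - 1) i j + (V - 1) i j)
  rw [← h1] at h2
  have h3 : ∑ j, ((U - 1) i j + (V - 1) i j) ^ 2 ≤ 4 * r ^ 2 := by
    calc ∑ j, ((U - 1) i j + (V - 1) i j) ^ 2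
        ≤ ∑ j, (2 * (U - 1) i j ^ 2 + 2 * (V - 1) i j ^ 2) :=
          Finset.sum_le_sum fun j _ => by
            nlinarith [sq_nonneg ((U - 1) i j - (V - 1) i j)]
      _ = 2 * ∑ j, (U - 1) i j ^ 2 + 2 * ∑ j, (V - 1) i j ^ 2 := by
          rw [Finset.sum_add_distrib, Finset.mul_sum, Finset.mul_sum]
      _ ≤ _ := by linarith [row_sq_le hUr i, row_sq_le hVr i]
  have h4 : 0 ≤ ∑ j, (U - V) i j ^ 2 := Finset.sum_nonneg fun j _ => sq_nonneg _
  nlinarith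

lemma cube_sub_cube_sq_le {u v m : ℝ} (hu : u ^ 2 ≤ m) (hv : v ^ 2 ≤ m) :
    (u ^ 3 - v ^ 3) ^ 2 ≤ 9 * m ^ 2 * (u - v) ^ 2 := by
  have h1 : u ^ 3 - v ^ 3 = (u ^ 2 + u * v + v ^ 2) * (u - v) := by ring
  rw [h1, mul_pow]
  refine mul_le_mul_of_nonneg_right ?_ (sq_nonneg _)
  have h2 : u ^ 2 + u * v + v ^ 2 ≤ 3 * m := by nlinarith [sq_nonneg (u - v)]
  have h3 : 0 ≤ u ^ 2 + u * v + v ^ 2 := by nlinarith [sq_nonneg (u + v)]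
  nlinarith [sq_nonneg u]

/-- Off the diagonal the entries are at most `r`, so the derivative of the cube is at most `3 r ^ 2
≤ 3 r`. On the diagonal it is only at most `3`, but there the increment itself carries a factor `r`.
The squares give `9 + 9 = 18`, whence `3√2`. -/
lemma norm_cube_sub_le {U V : Matrix (Fin n) (Fin n) ℝ} (hU : IsOrth U) (hV : IsOrth V)
    {r : ℝ} (hr : r ≤ 1) (hUr : ‖U - 1‖ ≤ r) (hVr : ‖V - 1‖ ≤ r) :
    ‖cube U - cube V‖ ≤ 3 * √2 * r * ‖U - V‖ := by
  have hr0 : 0 ≤ r := (norm_nonneg _).trans hUr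
  refine abs_le_of_sq_le_sq' ?_ (by positivity) |>.2
  have h18 : (3 * √2 * r * ‖U - V‖) ^ 2 = 18 * r ^ 2 * ‖U - V‖ ^ 2 := by
    rw [mul_pow, mul_pow, mul_pow, Real.sq_sqrt (by norm_num)]
    ring
  rw [h18, norm_sq_eq_sum, norm_sq_eq_sum, Finset.mul_sum]
  refine Finset.sum_le_sum fun i _ => ?_
  have hone : ∀ {W : Matrix (Fin n) (Fin n) ℝ}, IsOrth W → ∀ j, W i j ^ 2 ≤ 1 := by
    intro W hW j
    rw [← hW.row_sq_sum i]
    exact Finset.single_le_sum (f := fun j => W i j ^ 2) (fun j _ => sq_nonneg _)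
      (Finset.mem_univ j)
  have hoff : ∀ {W : Matrix (Fin n) (Fin n) ℝ}, ‖W - 1‖ ≤ r → ∀ j, i ≠ j → W i j ^ 2 ≤ r ^ 2 := by
    intro W hW j hij
    simpa [Matrix.one_apply_ne hij] using entry_sq_le hW i j
  have hterm : ∀ j, (cube U - cube V) i j ^ 2
      ≤ 9 * r ^ 2 * (U - V) i j ^ 2 + (if i = j then 9 * (U i j - V i j) ^ 2 else 0) := by
    intro j
    simp only [cube, Matrix.sub_apply, Matrix.map_apply]
    split_ifs with hij
    · have := cube_sub_cube_sq_le (hone hU j) (hone hV j)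
      nlinarith [mul_nonneg (sq_nonneg r) (sq_nonneg (U i j - V i j))]
    · have h1 := cube_sub_cube_sq_le (hoff hUr j hij) (hoff hVr j hij)
      have h2 : (r ^ 2) ^ 2 ≤ r ^ 2 := by nlinarith [pow_le_one₀ (n := 2) hr0 hr, sq_nonneg r]
      nlinarith [mul_le_mul_of_nonneg_right h2 (sq_nonneg (U i j - V i j))]
  refine (Finset.sum_le_sum fun j _ => hterm j).trans ?_
  rw [Finset.sum_add_distrib, Finset.sum_ite_eq, if_pos (Finset.mem_univ i), ← Finset.mul_sum]
  have := hU.diag_sub_sq_le hV hUr hVr i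
  nlinarith

/-- The expectation of `(U x)^{∘3} xᵀ` for orthogonal `U` and a vector `x` with i.i.d. `BG(θ)`
entries. -/
def meanCorr (θ : ℝ) (U : Matrix (Fin n) (Fin n) ℝ) : Matrix (Fin n) (Fin n) ℝ :=
  (3 * θ * (1 - θ)) • cube U + (3 * θ ^ 2) • U

lemma cube_one : cube (1 : Matrix (Fin n) (Fin n) ℝ) = 1 := by
  ext i j
  by_cases h : i = j <;> simp [cube, Matrix.one_apply, h]

lemma meanCorr_one (θ : ℝ) : meanCorr θ (1 : Matrix (Fin n) (Fin n) ℝ) = (3 * θ) • 1 := by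
  rw [meanCorr, cube_one, ← add_smul]
  congr 1
  ring

lemma norm_meanCorr_sub_le {U V : Matrix (Fin n) (Fin n) ℝ} (hU : IsOrth U) (hV : IsOrth V)
    {r θ : ℝ} (hr : r ≤ 1) (hUr : ‖U - 1‖ ≤ r) (hVr : ‖V - 1‖ ≤ r) (hθ : 0 ≤ θ) (hθ1 : θ ≤ 1) :
    ‖meanCorr θ U - meanCorr θ V‖
      ≤ (3 * θ ^ 2 + 9 * √2 * θ * (1 - θ) * r) * ‖U - V‖ := by
  have h1 : meanCorr θ U - meanCorr θ V
      = (3 * θ * (1 - θ)) • (cube U - cube V) + (3 * θ ^ 2) • (U - V) := by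
    simp only [meanCorr, smul_sub]
    abel
  have hc : 0 ≤ 3 * θ * (1 - θ) := mul_nonneg (by linarith) (by linarith)
  rw [h1]
  refine (norm_add_le _ _).trans ?_
  rw [norm_smul, norm_smul, Real.norm_of_nonneg hc, Real.norm_of_nonneg (by positivity)]
  have := mul_le_mul_of_nonneg_left (norm_cube_sub_le hU hV hr hUr hVr) hc
  linarith

/-- An orthogonal matrix close to the identity and with nearly maximal `‖U‖₄⁴` is close to the
identity at the matching rate. -/
lemma norm_sub_one_sq_le_l4 {U : Matrix (Fin n) (Fin n) ℝ} (hU : IsOrth U)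
    (hU1 : ‖U - 1‖ ≤ 1 / 2) : ‖U - 1‖ ^ 2 ≤ n - l4pow4 U := by
  have hn : (n : ℝ) = ∑ _i : Fin n, (1 : ℝ) := by simp
  rw [hn, l4pow4, norm_sq_eq_sum, ← Finset.sum_sub_distrib]
  refine Finset.sum_le_sum fun i _ => ?_
  have hrow := hU.row_sub_one_sq i
  have hle := row_sq_le hU1 i
  rw [hrow] at hle ⊢
  set c := U i i with hc
  have hsum := hU.row_sq_sum i
  rw [← Finset.add_sum_erase _ _ (Finset.mem_univ i)] at hsum ⊢
  have hc1 : c ^ 2 ≤ 1 := by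
    have : 0 ≤ ∑ j ∈ Finset.univ.erase i, U i j ^ 2 := Finset.sum_nonneg fun j _ => sq_nonneg _
    linarith
  have h4 : ∑ j ∈ Finset.univ.erase i, U i j ^ 4 ≤ (1 - c ^ 2) * (1 - c ^ 2) := by
    have : (1 - c ^ 2) = ∑ j ∈ Finset.univ.erase i, U i j ^ 2 := by linarith
    calc ∑ j ∈ Finset.univ.erase i, U i j ^ 4
        ≤ ∑ j ∈ Finset.univ.erase i, (1 - c ^ 2) * U i j ^ 2 := by
          refine Finset.sum_le_sum fun j hj => ?_
          have : U i j ^ 2 ≤ 1 - c ^ 2 := by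
            rw [this]
            exact Finset.single_le_sum (f := fun j => U i j ^ 2) (fun j _ => sq_nonneg _) hj
          nlinarith [sq_nonneg (U i j)]
      _ = _ := by rw [← Finset.mul_sum, ← this]
  have hc2 : c ≤ 1 := by nlinarith
  -- The row contributes at least `2 c² (1 - c²)` on the right, to be compared with `2 (1 - c)`;
  -- dividing by `1 - c` leaves this inequality. It holds because the radius `1 / 2` forces `c ≥ 7 /
  -- 8`.
  have h5 : (1 : ℝ) ≤ c ^ 2 * (1 + c) := by nlinarith [mul_self_nonneg (c - 7 / 8)]
  nlinarith [mul_nonneg (sub_nonneg.2 hc2) (sub_nonneg.2 h5)]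

/-! ### Equivariance under signed permutations -/

lemma signedPerm_mul_apply {π : Equiv.Perm (Fin n)} {s : Fin n → ℝ} {J : Type*}
    (M : Matrix (Fin n) J ℝ) (i : Fin n) (j : J) :
    ((Matrix.diagonal s * π.permMatrix ℝ) * M) i j = s i * M (π i) j := by
  rw [Matrix.mul_assoc, Matrix.diagonal_mul, Equiv.Perm.permMatrix, PEquiv.toMatrix_toPEquiv_mul,
    Matrix.submatrix_apply]
  rfl

lemma IsSignedPerm.isOrth {P : Matrix (Fin n) (Fin n) ℝ} (h : IsSignedPerm P) : IsOrth P := by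
  obtain ⟨π, s, hs, rfl⟩ := h
  refine IsOrth.mul ?_ ?_ <;> refine (Matrix.mem_orthogonalGroup_iff _ _).2 ?_
  · rw [Matrix.diagonal_transpose, Matrix.diagonal_mul_diagonal, ← Matrix.diagonal_one]
    congr 1
    ext i
    rcases hs i with h | h <;> simp [h]
  · rw [Matrix.transpose_permMatrix, ← Matrix.permMatrix_mul]
    simp

lemma IsSignedPerm.cube_mul {P : Matrix (Fin n) (Fin n) ℝ} (h : IsSignedPerm P) {J : Type*}
    (M : Matrix (Fin n) J ℝ) : cube (P * M) = P * cube M := by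
  obtain ⟨π, s, hs, rfl⟩ := h
  ext i j
  rw [signedPerm_mul_apply]
  simp only [cube, Matrix.map_apply]
  rw [signedPerm_mul_apply, mul_pow]
  rcases hs i with h | h <;> rw [h] <;> norm_num

lemma IsSignedPerm.cubeCorr_mul {P : Matrix (Fin n) (Fin n) ℝ} (h : IsSignedPerm P) {J : Type*}
    [Fintype J] (U : Matrix (Fin n) (Fin n) ℝ) (X : Matrix (Fin n) J ℝ) :
    cubeCorr (P * U) X = P * cubeCorr U X := by
  rw [cubeCorr, Matrix.mul_assoc, h.cube_mul, Matrix.mul_assoc, cubeCorr]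

lemma IsSignedPerm.l4pow4_mul {P : Matrix (Fin n) (Fin n) ℝ} (h : IsSignedPerm P)
    (M : Matrix (Fin n) (Fin n) ℝ) : l4pow4 (P * M) = l4pow4 M := by
  obtain ⟨π, s, hs, rfl⟩ := h
  simp only [l4pow4, signedPerm_mul_apply]
  rw [← Equiv.sum_comp π (fun i => ∑ j, M i j ^ 4)]
  refine Finset.sum_congr rfl fun i _ => Finset.sum_congr rfl fun j _ => ?_
  rcases hs i with h | h <;> rw [h] <;> ring

lemma cubeCorr_concat {N : ℕ} {p : Fin N → ℕ} (U : Matrix (Fin n) (Fin n) ℝ)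
    (X : (i : Fin N) → Matrix (Fin n) (Fin (p i)) ℝ) :
    cubeCorr U (concat X) = ∑ i, cubeCorr U (X i) := by
  ext a b
  simp [cubeCorr, Matrix.mul_apply, Matrix.sum_apply, Fintype.sum_sigma, cube, concat]


/-! ### The fourth-moment tensor and its deviation -/

/-- Kronecker's delta. -/
def kron (a b : Fin n) : ℝ := if a = b then 1 else 0

/-- The fourth moments `E[x_c x_d x_e x_b]` of a vector with i.i.d. `BG(θ)` entries. -/
noncomputable def fourthMoment (θ : ℝ) (c d e b : Fin n) : ℝ :=
  θ ^ 2 * (kron c d * kron e b + kron c e * kron d b + kron c b * kron d e)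
    + 3 * θ * (1 - θ) * (kron c d * kron c e * kron c b)

/-- The deviation of the empirical fourth moments from the theoretical ones, unnormalized. -/
noncomputable def dev {J : Type*} [Fintype J] (θ : ℝ) (X : Matrix (Fin n) J ℝ) (c d e b : Fin n) : ℝ :=
  ∑ q, X c q * X d q * X e q * X b q - Fintype.card J * fourthMoment θ c d e b

/-- The squared norm of the tensor of deviations. -/
noncomputable def devSq {J : Type*} [Fintype J] (θ : ℝ) (X : Matrix (Fin n) J ℝ) : ℝ :=
  ∑ b, ∑ c, ∑ d, ∑ e, dev θ X c d e b ^ 2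

/-- The part of `devSq` that is seen by the correlation matrix at the identity. -/
noncomputable def devDiagSq {J : Type*} [Fintype J] (θ : ℝ) (X : Matrix (Fin n) J ℝ) : ℝ :=
  ∑ b, ∑ a, dev θ X a a a b ^ 2

lemma sum_fourthMoment {U : Matrix (Fin n) (Fin n) ℝ} (hU : IsOrth U) (θ : ℝ) (a b : Fin n) :
    ∑ c, ∑ d, ∑ e, U a c * U a d * U a e * fourthMoment θ c d e b = meanCorr θ U a b := by
  have h1 : ∑ d, U a d * U a d = 1 := by simpa [sq] using hU.row_sq_sum a
  have e1 : ∀ c d e, U a c * U a d * U a e * fourthMoment θ c d e b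
      = θ ^ 2 * (kron c d * (U a c * U a d) * (kron e b * U a e))
        + θ ^ 2 * (kron c e * (U a c * U a e) * (kron d b * U a d))
        + θ ^ 2 * (kron c b * U a c * (kron d e * (U a d * U a e)))
        + 3 * θ * (1 - θ) * (kron c d * kron c e * kron c b * (U a c * U a d * U a e)) := by
    intro c d e
    simp only [fourthMoment]
    ring
  simp only [e1, Finset.sum_add_distrib, ← Finset.mul_sum, kron]
  simp only [ite_mul, mul_ite, one_mul, zero_mul, mul_zero, Finset.sum_ite_eq,
    Finset.sum_ite_eq', Finset.mem_univ, if_true, mul_one, Finset.sum_ite_irrel,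
    Finset.sum_const_zero, ← Finset.sum_mul, h1]
  simp only [meanCorr, cube, Matrix.add_apply, Matrix.smul_apply, Matrix.map_apply, smul_eq_mul]
  ring

/-- Expanding the cube separates the dictionary from the data: all randomness sits in `dev`, so
bounds on it are uniform over orthogonal `U`. -/
lemma cubeCorr_sub_apply {J : Type*} [Fintype J] {U : Matrix (Fin n) (Fin n) ℝ} (hU : IsOrth U)
    (θ : ℝ) (X : Matrix (Fin n) J ℝ) (a b : Fin n) :
    (cubeCorr U X - (Fintype.card J : ℝ) • meanCorr θ U) a b
      = ∑ c, ∑ d, ∑ e, U a c * U a d * U a e * dev θ X c d e b := by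
  simp only [dev, mul_sub, Finset.sum_sub_distrib]
  rw [Matrix.sub_apply, Matrix.smul_apply, ← sum_fourthMoment hU]
  congr 1
  · have h3 : ∀ q, (U * X) a q ^ 3 * X b q
        = ∑ c, ∑ d, ∑ e, U a c * U a d * U a e * (X c q * X d q * X e q * X b q) := by
      intro q
      have : (U * X) a q ^ 3 = (U * X) a q * ((U * X) a q * (U * X) a q) := by ring
      rw [this, Matrix.mul_apply, Finset.sum_mul_sum, Finset.sum_mul_sum, Finset.sum_mul]
      refine Finset.sum_congr rfl fun c _ => ?_
      rw [Finset.sum_mul]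
      refine Finset.sum_congr rfl fun d _ => ?_
      rw [Finset.mul_sum, Finset.sum_mul]
      refine Finset.sum_congr rfl fun e _ => ?_
      ring
    have h4 : cubeCorr U X a b = ∑ q, (U * X) a q ^ 3 * X b q := by
      simp [cubeCorr, cube, Matrix.mul_apply (M := Matrix.map _ _)]
    rw [h4, Finset.sum_congr rfl fun q _ => h3 q, Finset.sum_comm]
    refine Finset.sum_congr rfl fun c _ => ?_
    rw [Finset.sum_comm]
    refine Finset.sum_congr rfl fun d _ => ?_
    rw [Finset.sum_comm]
    refine Finset.sum_congr rfl fun e _ => ?_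
    rw [Finset.mul_sum]
  · simp only [smul_eq_mul, Finset.mul_sum]
    refine Finset.sum_congr rfl fun c _ => Finset.sum_congr rfl fun d _ =>
      Finset.sum_congr rfl fun e _ => ?_
    ring

/-- For unit rows with inner product `t`, the tensor cubes have inner product `t ^ 3`. The claim
becomes `2 (1 - t ^ 3) ≤ 8 (1 - t)`, which follows from `1 + t + t ^ 2 ≤ 3`. -/
lemma sum_cube_sub_sq {U V : Matrix (Fin n) (Fin n) ℝ} (hU : IsOrth U) (hV : IsOrth V)
    (a : Fin n) :
    ∑ c, ∑ d, ∑ e, (U a c * U a d * U a e - V a c * V a d * V a e) ^ 2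
      ≤ 4 * ∑ j, (U - V) a j ^ 2 := by
  set t := ∑ j, U a j * V a j with ht
  have hu := hU.row_sq_sum a
  have hv := hV.row_sq_sum a
  have h1 : ∑ j, (U - V) a j ^ 2 = 2 * (1 - t) := by
    have : ∀ j, (U - V) a j ^ 2 = U a j ^ 2 + V a j ^ 2 - 2 * (U a j * V a j) := by
      intro j
      rw [Matrix.sub_apply]
      ring
    simp only [this, Finset.sum_sub_distrib, Finset.sum_add_distrib, ← Finset.mul_sum, hu, hv]
    rw [← ht]
    ring
  have h2 : ∑ c, ∑ d, ∑ e, (U a c * U a d * U a e - V a c * V a d * V a e) ^ 2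
      = 2 * (1 - t ^ 3) := by
    have : ∀ c d e, (U a c * U a d * U a e - V a c * V a d * V a e) ^ 2
        = U a c ^ 2 * (U a d ^ 2 * U a e ^ 2) + V a c ^ 2 * (V a d ^ 2 * V a e ^ 2)
          - 2 * ((U a c * V a c) * ((U a d * V a d) * (U a e * V a e))) := by
      intro c d e
      ring
    simp only [this, Finset.sum_sub_distrib, Finset.sum_add_distrib, ← Finset.mul_sum,
      ← Finset.sum_mul, hu, hv]
    rw [← ht]
    ring
  have h3 : t ^ 2 ≤ 1 := by
    have := Finset.sum_mul_sq_le_sq_mul_sq Finset.univ (fun j => U a j) (fun j => V a j)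
    rwa [hu, hv, one_mul] at this
  have h4 : t ≤ 1 := by nlinarith
  rw [h1, h2]
  nlinarith [mul_nonneg (sub_nonneg.2 h4) (sub_nonneg.2 h3)]

/-- The deviation of the correlation matrix from its mean is Lipschitz in the dictionary, with
constant governed by the fourth-moment tensor. -/
lemma norm_cubeCorr_dev_sub_le {J : Type*} [Fintype J] {U V : Matrix (Fin n) (Fin n) ℝ}
    (hU : IsOrth U) (hV : IsOrth V) (θ : ℝ) (X : Matrix (Fin n) J ℝ) :
    ‖(cubeCorr U X - (Fintype.card J : ℝ) • meanCorr θ U)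
        - (cubeCorr V X - (Fintype.card J : ℝ) • meanCorr θ V)‖
      ≤ 2 * √(devSq θ X) * ‖U - V‖ := by
  have hQ : 0 ≤ devSq θ X := by unfold devSq; positivity
  refine abs_le_of_sq_le_sq' ?_ (by positivity) |>.2
  rw [mul_pow, mul_pow, Real.sq_sqrt hQ, norm_sq_eq_sum, norm_sq_eq_sum, Finset.mul_sum]
  refine Finset.sum_le_sum fun a _ => ?_
  have key : ∀ b, ((cubeCorr U X - (Fintype.card J : ℝ) • meanCorr θ U)
        - (cubeCorr V X - (Fintype.card J : ℝ) • meanCorr θ V)) a b ^ 2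
      ≤ (4 * ∑ j, (U - V) a j ^ 2) * ∑ c, ∑ d, ∑ e, dev θ X c d e b ^ 2 := by
    intro b
    rw [Matrix.sub_apply, cubeCorr_sub_apply hU, cubeCorr_sub_apply hV]
    refine le_trans ?_ (mul_le_mul_of_nonneg_right (sum_cube_sub_sq hU hV a) (by positivity))
    simp only [← Finset.sum_sub_distrib, ← sub_mul]
    have := Finset.sum_mul_sq_le_sq_mul_sq (Finset.univ : Finset (Fin n × Fin n × Fin n))
      (fun x => U a x.1 * U a x.2.1 * U a x.2.2 - V a x.1 * V a x.2.1 * V a x.2.2)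
      (fun x => dev θ X x.1 x.2.1 x.2.2 b)
    simpa only [Fintype.sum_prod_type] using this
  refine (Finset.sum_le_sum fun b _ => key b).trans ?_
  rw [← Finset.mul_sum, ← devSq]
  exact le_of_eq (by ring)

/-- The identity sees only `n ^ 2` entries of the tensor instead of `n ^ 4`. This sharper count
matters because this part of the noise is not multiplied by a distance between dictionaries. -/
lemma norm_cubeCorr_dev_one {J : Type*} [Fintype J] (θ : ℝ) (X : Matrix (Fin n) J ℝ) :
    ‖cubeCorr 1 X - (Fintype.card J : ℝ) • meanCorr θ 1‖ = √(devDiagSq θ X) := by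
  rw [← Real.sqrt_sq (norm_nonneg (cubeCorr 1 X - _)), norm_sq_eq_sum, Finset.sum_comm]
  congr 1
  refine Finset.sum_congr rfl fun b _ => Finset.sum_congr rfl fun a _ => ?_
  rw [cubeCorr_sub_apply isOrth_one]
  simp [Matrix.one_apply]

end Matrices

/-! ### Moments of the Gaussian and Bernoulli-Gaussian laws -/

section Moments

lemma integrable_pow_gaussianReal (k : ℕ) :
    Integrable (fun x : ℝ => x ^ k) (gaussianReal 0 1) := by
  rcases Nat.eq_zero_or_pos k with rfl | hk
  · simp
  · have h := (memLp_id_gaussianReal' (μ := 0) (v := 1) (k : ENNReal) (by simp)).integrable_norm_pow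
      hk.ne'
    refine h.mono' (by fun_prop) (Filter.Eventually.of_forall fun x => ?_)
    simp

lemma integral_sq_gaussianReal : ∫ x, x ^ 2 ∂(gaussianReal 0 1) = 1 := by
  have h := variance_of_integral_eq_zero (μ := gaussianReal 0 1) (X := fun x => x)
    (by fun_prop) (by simp)
  rw [← h]
  simp

lemma integral_pow_four_gaussianReal : ∫ x, x ^ 4 ∂(gaussianReal 0 1) = 3 := by
  rw [integral_gaussianReal_eq_integral_smul one_ne_zero]
  have h1 : ∀ x : ℝ, gaussianPDFReal 0 1 x • x ^ 4
      = (fun y : ℝ => (√(2 * Real.pi))⁻¹ * (y ^ (4 : ℝ) * Real.exp (-(1 / 2) * y ^ (2 : ℝ)))) |x| := by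
    intro x
    have e4 : |x| ^ (4 : ℝ) = x ^ 4 := by
      rw [show (4 : ℝ) = ((4 : ℕ) : ℝ) by norm_num, Real.rpow_natCast]
      exact Even.pow_abs (by decide) x
    have e2 : |x| ^ (2 : ℝ) = x ^ 2 := by
      rw [show (2 : ℝ) = ((2 : ℕ) : ℝ) by norm_num, Real.rpow_natCast]
      exact sq_abs x
    simp only [e4, e2, gaussianPDFReal, smul_eq_mul, NNReal.coe_one, mul_one, sub_zero]
    rw [show -x ^ 2 / 2 = -(1 / 2) * x ^ 2 by ring]
    ring
  simp only [h1]
  rw [integral_comp_abs (f := fun y : ℝ =>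
    (√(2 * Real.pi))⁻¹ * (y ^ (4 : ℝ) * Real.exp (-(1 / 2) * y ^ (2 : ℝ)))),
    integral_const_mul, integral_rpow_mul_exp_neg_mul_rpow (by norm_num) (by norm_num)
      (by norm_num)]
  have hG : Real.Gamma ((4 + 1) / 2) = 3 * √Real.pi / 4 := by
    have := Real.Gamma_nat_add_half 2
    rw [show (4 + 1) / 2 = ((2 : ℕ) : ℝ) + 1 / 2 by norm_num, this]
    norm_num [Nat.doubleFactorial]
  have hr : (1 / 2 : ℝ) ^ (-(4 + 1) / 2 : ℝ) = 4 * √2 := by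
    rw [one_div, Real.inv_rpow (by norm_num), ← Real.rpow_neg (by norm_num),
      show -(-(4 + 1) / 2 : ℝ) = (2 : ℕ) + 1 / 2 by norm_num, Real.rpow_add (by norm_num),
      Real.rpow_natCast, ← Real.sqrt_eq_rpow]
    norm_num
  rw [hG, hr, Real.sqrt_mul (by norm_num)]
  have h2 : √2 ≠ 0 := by positivity
  have hpi : √Real.pi ≠ 0 := (Real.sqrt_pos.2 Real.pi_pos).ne'
  field_simp

variable {θ : ℝ}

lemma integrable_pow_bernoulliGaussian (k : ℕ) :
    Integrable (fun x : ℝ => x ^ k) (bernoulliGaussian θ) := by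
  unfold bernoulliGaussian
  refine Integrable.add_measure (Integrable.smul_measure ?_ (by simp))
    ((integrable_pow_gaussianReal k).smul_measure (by simp))
  exact integrable_dirac (by simp)

lemma integral_pow_bernoulliGaussian (hθ : 0 ≤ θ) {k : ℕ} (hk : k ≠ 0) :
    ∫ x, x ^ k ∂(bernoulliGaussian θ) = θ * ∫ x, x ^ k ∂(gaussianReal 0 1) := by
  unfold bernoulliGaussian
  rw [integral_add_measure (Integrable.smul_measure (integrable_dirac (by simp)) (by simp))
    ((integrable_pow_gaussianReal k).smul_measure (by simp)), integral_smul_measure,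
    integral_smul_measure, integral_dirac, ENNReal.toReal_ofReal hθ]
  simp [hk]

/-- An upper bound for the eighth moment of a standard Gaussian. -/
noncomputable def gaussEight : ℝ := ∫ x, x ^ 8 ∂(gaussianReal 0 1) + 1

lemma gaussEight_pos : 0 < gaussEight := by
  have : 0 ≤ ∫ x, x ^ 8 ∂(gaussianReal 0 1) :=
    integral_nonneg fun x => Even.pow_nonneg (by decide) x
  unfold gaussEight
  linarith

end Moments

/-! ### Mixed moments of one column of data -/

section Column

variable {Ω : Type*} [MeasurableSpace Ω] {μ : Measure Ω} {θ : ℝ} {ι : Type*} {f : ι → Ω → ℝ}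

lemma integrable_pow_of_law (hm : ∀ i, Measurable (f i))
    (hl : ∀ i, μ.map (f i) = bernoulliGaussian θ) (i : ι) (k : ℕ) :
    Integrable (fun ω => f i ω ^ k) μ := by
  have h := integrable_pow_bernoulliGaussian (θ := θ) k
  rw [← hl i] at h
  exact h.comp_measurable (hm i)

lemma integral_pow_of_law (hm : ∀ i, Measurable (f i))
    (hl : ∀ i, μ.map (f i) = bernoulliGaussian θ) (hθ : 0 ≤ θ) (i : ι) {k : ℕ} (hk : k ≠ 0) :
    ∫ ω, f i ω ^ k ∂μ = θ * ∫ x, x ^ k ∂(gaussianReal 0 1) := by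
  rw [← integral_pow_bernoulliGaussian hθ hk, ← hl i,
    integral_map (hm i).aemeasurable (by fun_prop)]

/-- The indices `c`, `d`, `e` may coincide, so independence is used between the blocks `{a}` and
`{c, d, e}`; the centred factor then kills the product. -/
lemma integral_mul_eq_zero_of_notMem [IsProbabilityMeasure μ] [DecidableEq ι]
    (hm : ∀ i, Measurable (f i)) (hl : ∀ i, μ.map (f i) = bernoulliGaussian θ) (hθ : 0 ≤ θ)
    (hi : iIndepFun f μ) {a c d e : ι} (hc : a ≠ c) (hd : a ≠ d) (he : a ≠ e) :
    ∫ ω, f a ω * (f c ω * f d ω * f e ω) ∂μ = 0 := by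
  have h := hi.indepFun_finset {a} {c, d, e} (by simp [hc, hd, he]) hm
  have hφ : Measurable fun g : ({a} : Finset ι) → ℝ => g ⟨a, by simp⟩ := measurable_pi_apply _
  have h' := h.comp (φ := fun g : ({a} : Finset ι) → ℝ => g ⟨a, by simp⟩)
    (ψ := fun g : ({c, d, e} : Finset ι) → ℝ =>
      g ⟨c, by simp⟩ * g ⟨d, by simp⟩ * g ⟨e, by simp⟩) hφ (by fun_prop)
  have h0 : ∫ ω, f a ω ∂μ = 0 := by
    have := integral_pow_of_law hm hl hθ a one_ne_zero
    simpa using this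
  have h2 := h'.integral_fun_mul_eq_mul_integral
    (Measurable.aestronglyMeasurable (by fun_prop)) (Measurable.aestronglyMeasurable (by fun_prop))
  simp only [Function.comp_apply] at h2
  rw [h2, h0, zero_mul]

lemma integral_sq_mul_sq [IsProbabilityMeasure μ]
    (hm : ∀ i, Measurable (f i)) (hl : ∀ i, μ.map (f i) = bernoulliGaussian θ) (hθ : 0 ≤ θ)
    (hi : iIndepFun f μ) {a b : ι} (hab : a ≠ b) :
    ∫ ω, f a ω ^ 2 * f b ω ^ 2 ∂μ = θ ^ 2 := by
  have h := (hi.indepFun hab).comp (φ := fun x => x ^ 2) (ψ := fun x => x ^ 2)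
    (by fun_prop) (by fun_prop)
  have h2 := h.integral_fun_mul_eq_mul_integral
    (Measurable.aestronglyMeasurable (by fun_prop)) (Measurable.aestronglyMeasurable (by fun_prop))
  simp only [Function.comp_apply] at h2
  rw [h2, integral_pow_of_law hm hl hθ a two_ne_zero, integral_pow_of_law hm hl hθ b two_ne_zero,
    integral_sq_gaussianReal]
  ring

lemma integral_four {n : ℕ} {f : Fin n → Ω → ℝ} [IsProbabilityMeasure μ]
    (hm : ∀ i, Measurable (f i)) (hl : ∀ i, μ.map (f i) = bernoulliGaussian θ) (hθ : 0 ≤ θ)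
    (hi : iIndepFun f μ) (c d e b : Fin n) :
    ∫ ω, f c ω * f d ω * f e ω * f b ω ∂μ = fourthMoment θ c d e b := by
  have hz := fun {a c d e : Fin n} => integral_mul_eq_zero_of_notMem (a := a) (c := c) (d := d)
    (e := e) hm hl hθ hi
  -- If the last index differs from the other three the moment vanishes. Otherwise symmetry moves
  -- its match to the first slot, and this case remains.
  have key : ∀ b d e : Fin n,
      ∫ ω, f b ω * f d ω * f e ω * f b ω ∂μ = fourthMoment θ b d e b := by
    intro b d e
    by_cases hde : d = e
    · subst hde
      by_cases hdb : d = b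
      · subst hdb
        have := integral_pow_of_law hm hl hθ d four_ne_zero
        rw [integral_pow_four_gaussianReal] at this
        simp only [fourthMoment, kron, if_true]
        rw [show (θ ^ 2 * (1 * 1 + 1 * 1 + 1 * 1) + 3 * θ * (1 - θ) * (1 * 1 * 1) : ℝ) = θ * 3 by
          ring, ← this]
        refine integral_congr_ae (Filter.Eventually.of_forall fun ω => ?_)
        simp only
        ring
      · have := integral_sq_mul_sq hm hl hθ hi hdb
        have hF : fourthMoment θ b d d b = θ ^ 2 := by
          simp [fourthMoment, kron, hdb, Ne.symm hdb]
        rw [hF, ← this]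
        refine integral_congr_ae (Filter.Eventually.of_forall fun ω => ?_)
        simp only
        ring
    · have hF : fourthMoment θ b d e b = 0 := by
        simp only [fourthMoment, kron]
        grind
      rw [hF]
      by_cases hdb : d = b
      · subst hdb
        rw [← hz (Ne.symm hde) (Ne.symm hde) (Ne.symm hde)]
        refine integral_congr_ae (Filter.Eventually.of_forall fun ω => ?_)
        simp only
        ring
      · rw [← hz hdb hde hdb]
        refine integral_congr_ae (Filter.Eventually.of_forall fun ω => ?_)
        simp only
        ring
  by_cases hbc : b = c
  · subst hbc
    exact key b d e
  by_cases hbd : b = d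
  · subst hbd
    have hF : fourthMoment θ c b e b = fourthMoment θ b c e b := by
      simp only [fourthMoment, kron]
      grind
    rw [hF, ← key]
    refine integral_congr_ae (Filter.Eventually.of_forall fun ω => ?_)
    simp only
    ring
  by_cases hbe : b = e
  · subst hbe
    have hF : fourthMoment θ c d b b = fourthMoment θ b d c b := by
      simp only [fourthMoment, kron]
      grind
    rw [hF, ← key]
    refine integral_congr_ae (Filter.Eventually.of_forall fun ω => ?_)
    simp only
    ring
  have hF : fourthMoment θ c d e b = 0 := by
    simp only [fourthMoment, kron]
    grind
  rw [hF, ← hz hbc hbd hbe]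
  refine integral_congr_ae (Filter.Eventually.of_forall fun ω => ?_)
  simp only
  ring

lemma sq_mul_le_pow_eight (a b c d : ℝ) :
    (a * b * c * d) ^ 2 ≤ (a ^ 8 + b ^ 8 + c ^ 8 + d ^ 8) / 4 := by
  nlinarith [sq_nonneg (a ^ 2 * b ^ 2 - c ^ 2 * d ^ 2), sq_nonneg (a ^ 4 - b ^ 4),
    sq_nonneg (c ^ 4 - d ^ 4)]

lemma integrable_sq_mul (hm : ∀ i, Measurable (f i))
    (hl : ∀ i, μ.map (f i) = bernoulliGaussian θ) (c d e b : ι) :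
    Integrable (fun ω => (f c ω * f d ω * f e ω * f b ω) ^ 2) μ := by
  have h := fun i => integrable_pow_of_law hm hl i 8
  refine ((((h c).add (h d)).add (h e)).add (h b)).div_const 4 |>.mono'
    (Measurable.aestronglyMeasurable (by fun_prop)) (Filter.Eventually.of_forall fun ω => ?_)
  rw [Real.norm_of_nonneg (sq_nonneg _)]
  exact sq_mul_le_pow_eight _ _ _ _

lemma integral_sq_mul_le (hm : ∀ i, Measurable (f i))
    (hl : ∀ i, μ.map (f i) = bernoulliGaussian θ) (hθ : 0 ≤ θ) (c d e b : ι) :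
    ∫ ω, (f c ω * f d ω * f e ω * f b ω) ^ 2 ∂μ ≤ gaussEight * θ := by
  have h := fun i => integrable_pow_of_law hm hl i 8
  have hv := fun i => integral_pow_of_law hm hl hθ i (k := 8) (by norm_num)
  have h1 := integral_mono (integrable_sq_mul hm hl c d e b)
    (((((h c).add (h d)).add (h e)).add (h b)).div_const 4)
    fun ω => sq_mul_le_pow_eight (f c ω) (f d ω) (f e ω) (f b ω)
  refine h1.trans ?_
  rw [integral_div, integral_add' (((h c).add (h d)).add (h e)) (h b),
    integral_add' ((h c).add (h d)) (h e), integral_add' (h c) (h d), hv, hv, hv, hv]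
  unfold gaussEight
  nlinarith

end Column

/-! ### Variance of the empirical fourth moments and the good event -/

section Data

variable {Ω : Type*} [MeasurableSpace Ω] {μ : Measure Ω} [IsProbabilityMeasure μ] {θ : ℝ}
  {n : ℕ} {J : Type*} [Fintype J] [DecidableEq J] {X : Ω → Matrix (Fin n) J ℝ}

/-- `dev` is a centred sum of independent column contributions, so variances add; each is at most a
second moment of a product of four entries, controlled by eighth moments. -/
lemma integrable_dev_sq_and_integral_le (hm : ∀ a j, Measurable fun ω => X ω a j)
    (hl : ∀ a j, μ.map (fun ω => X ω a j) = bernoulliGaussian θ) (hθ : 0 ≤ θ)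
    (hi : iIndepFun (fun (q : Fin n × J) (ω : Ω) => X ω q.1 q.2) μ) (c d e b : Fin n) :
    Integrable (fun ω => dev θ (X ω) c d e b ^ 2) μ ∧
      ∫ ω, dev θ (X ω) c d e b ^ 2 ∂μ ≤ Fintype.card J * (gaussEight * θ) := by
  set Y : J → Ω → ℝ := fun q ω => X ω c q * X ω d q * X ω e q * X ω b q with hY
  have hYm : ∀ q, Measurable (Y q) := fun q => by
    have := hm c q; have := hm d q; have := hm e q; have := hm b q
    fun_prop
  have hY2 : ∀ q, MemLp (Y q) 2 μ := fun q =>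
    (memLp_two_iff_integrable_sq (hYm q).aestronglyMeasurable).2
      (integrable_sq_mul (f := fun a ω => X ω a q) (fun a => hm a q) (fun a => hl a q) c d e b)
  have hcol : ∀ q, iIndepFun (fun (a : Fin n) (ω : Ω) => X ω a q) μ := fun q =>
    hi.precomp (g := fun a => (a, q)) fun a b h => (Prod.ext_iff.1 h).1
  have hmean : ∀ q, ∫ ω, Y q ω ∂μ = fourthMoment θ c d e b := fun q =>
    integral_four (fun a => hm a q) (fun a => hl a q) hθ (hcol q) c d e b
  have hind : Set.Pairwise (↑(Finset.univ : Finset J)) fun q q' => IndepFun (Y q) (Y q') μ := by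
    intro q _ q' _ hqq
    have hdis : Disjoint ((Finset.univ : Finset (Fin n)).image fun a => (a, q))
        (Finset.univ.image fun a => (a, q')) := by
      rw [Finset.disjoint_left]
      simp only [Finset.mem_image, Finset.mem_univ, true_and]
      rintro _ ⟨a, rfl⟩ ⟨a', h⟩
      exact hqq (Prod.ext_iff.1 h).2.symm
    have h := hi.indepFun_finset _ _ hdis (fun x => hm x.1 x.2)
    exact h.comp
      (φ := fun g : ((Finset.univ : Finset (Fin n)).image fun a => (a, q)) → ℝ =>
        g ⟨(c, q), by simp⟩ * g ⟨(d, q), by simp⟩ * g ⟨(e, q), by simp⟩ * g ⟨(b, q), by simp⟩)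
      (ψ := fun g : ((Finset.univ : Finset (Fin n)).image fun a => (a, q')) → ℝ =>
        g ⟨(c, q'), by simp⟩ * g ⟨(d, q'), by simp⟩ * g ⟨(e, q'), by simp⟩ * g ⟨(b, q'), by simp⟩)
      (by fun_prop) (by fun_prop)
  have hsum : MemLp (∑ q, Y q) 2 μ := memLp_finsetSum' _ fun q _ => hY2 q
  have hEsum : ∫ ω, (∑ q, Y q) ω ∂μ = Fintype.card J * fourthMoment θ c d e b := by
    simp only [Finset.sum_apply]
    rw [integral_finsetSum _ fun q _ => (hY2 q).integrable one_le_two]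
    simp [hmean]
  have hdev : ∀ ω, dev θ (X ω) c d e b = (∑ q, Y q) ω - ∫ ω, (∑ q, Y q) ω ∂μ := by
    intro ω
    rw [hEsum, Finset.sum_apply, dev]
  have hvar := variance_eq_integral hsum.aestronglyMeasurable.aemeasurable
  simp only [hdev]
  refine ⟨(hsum.sub (memLp_const _)).integrable_sq, ?_⟩
  rw [← hvar, IndepFun.variance_sum (fun q _ => hY2 q) hind]
  calc ∑ q, Var[Y q; μ] ≤ ∑ _q : J, gaussEight * θ := by
        refine Finset.sum_le_sum fun q _ => ?_
        exact (variance_le_expectation_sq (hYm q).aestronglyMeasurable).trans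
          (integral_sq_mul_le (f := fun a ω => X ω a q) (fun a => hm a q) (fun a => hl a q)
            hθ c d e b)
    _ = _ := by simp

lemma integrable_devSq_and_integral_le (hm : ∀ a j, Measurable fun ω => X ω a j)
    (hl : ∀ a j, μ.map (fun ω => X ω a j) = bernoulliGaussian θ) (hθ : 0 ≤ θ)
    (hi : iIndepFun (fun (q : Fin n × J) (ω : Ω) => X ω q.1 q.2) μ) :
    Integrable (fun ω => devSq θ (X ω)) μ ∧
      ∫ ω, devSq θ (X ω) ∂μ ≤ n ^ 4 * (Fintype.card J * (gaussEight * θ)) := by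
  have h := integrable_dev_sq_and_integral_le hm hl hθ hi
  have e : ∀ Y : Matrix (Fin n) J ℝ, devSq θ Y
      = ∑ x : Fin n × Fin n × Fin n × Fin n, dev θ Y x.2.1 x.2.2.1 x.2.2.2 x.1 ^ 2 := by
    intro Y
    simp only [devSq, Fintype.sum_prod_type]
  simp only [e]
  refine ⟨integrable_finsetSum _ fun x _ => (h _ _ _ _).1, ?_⟩
  rw [integral_finsetSum _ fun x _ => (h _ _ _ _).1]
  refine (Finset.sum_le_sum fun x _ => (h _ _ _ _).2).trans (le_of_eq ?_)
  simp only [Finset.sum_const, Finset.card_univ, Fintype.card_prod, Fintype.card_fin,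
    nsmul_eq_mul]
  push_cast
  ring

lemma integrable_devDiagSq_and_integral_le (hm : ∀ a j, Measurable fun ω => X ω a j)
    (hl : ∀ a j, μ.map (fun ω => X ω a j) = bernoulliGaussian θ) (hθ : 0 ≤ θ)
    (hi : iIndepFun (fun (q : Fin n × J) (ω : Ω) => X ω q.1 q.2) μ) :
    Integrable (fun ω => devDiagSq θ (X ω)) μ ∧
      ∫ ω, devDiagSq θ (X ω) ∂μ ≤ n ^ 2 * (Fintype.card J * (gaussEight * θ)) := by
  have h := integrable_dev_sq_and_integral_le hm hl hθ hi
  have e : ∀ Y : Matrix (Fin n) J ℝ, devDiagSq θ Y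
      = ∑ x : Fin n × Fin n, dev θ Y x.2 x.2 x.2 x.1 ^ 2 := by
    intro Y
    simp only [devDiagSq, Fintype.sum_prod_type]
  simp only [e]
  refine ⟨integrable_finsetSum _ fun x _ => (h _ _ _ _).1, ?_⟩
  rw [integral_finsetSum _ fun x _ => (h _ _ _ _).1]
  refine (Finset.sum_le_sum fun x _ => (h _ _ _ _).2).trans (le_of_eq ?_)
  simp only [Finset.sum_const, Finset.card_univ, Fintype.card_prod, Fintype.card_fin,
    nsmul_eq_mul]
  push_cast
  ring

end Data

/-- With probability at least `1 - η` the empirical fourth moments at all the nodes are close to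
their expectations. -/
lemma exists_event {n N : ℕ} {p : Fin N → ℕ} {Ω : Type*} [MeasurableSpace Ω] {μ : Measure Ω}
    [IsProbabilityMeasure μ] {θ η : ℝ} {X : (i : Fin N) → Ω → Matrix (Fin n) (Fin (p i)) ℝ}
    (hX : IsBGData μ θ X) (hθ : 0 < θ) (hη : 0 < η) (hn : 0 < n) (hp : 0 < ∑ i, p i) :
    ∃ G : Set Ω, MeasurableSet G ∧ 1 - η ≤ μ.real G ∧ ∀ ω ∈ G,
      ∑ i, (devSq θ (X i ω) + n ^ 2 * devDiagSq θ (X i ω))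
        ≤ 2 * n ^ 4 * (gaussEight * θ) * (∑ i, p i : ℕ) / η := by
  have hi : ∀ i, iIndepFun (fun (q : Fin n × Fin (p i)) (ω : Ω) => X i ω q.1 q.2) μ := by
    intro i
    refine hX.indep.precomp (g := fun q : Fin n × Fin (p i) => ⟨i, q⟩) ?_
    intro q q' h
    simpa using h
  have hQ := fun i => integrable_devSq_and_integral_le (hX.measurable i) (hX.law i) hθ.le (hi i)
  have hR := fun i =>
    integrable_devDiagSq_and_integral_le (hX.measurable i) (hX.law i) hθ.le (hi i)
  -- The weight `n ^ 2` equalizes the mean bounds of the two parts, of orders `n ^ 4` and `n ^ 2`,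
  -- so one application of Markov's inequality controls both.
  set Z : Ω → ℝ := fun ω => ∑ i, (devSq θ (X i ω) + n ^ 2 * devDiagSq θ (X i ω)) with hZ
  set m : ℝ := 2 * n ^ 4 * (gaussEight * θ) * (∑ i, p i : ℕ) with hm
  have hint : ∀ i, Integrable (fun ω => devSq θ (X i ω) + n ^ 2 * devDiagSq θ (X i ω)) μ :=
    fun i => (hQ i).1.add ((hR i).1.const_mul _)
  have hZi : Integrable Z μ := integrable_finsetSum _ fun i _ => hint i
  have hZE : ∫ ω, Z ω ∂μ ≤ m := by
    rw [hZ, integral_finsetSum _ fun i _ => hint i, hm]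
    push_cast
    rw [Finset.mul_sum]
    refine Finset.sum_le_sum fun i _ => ?_
    rw [integral_add (hQ i).1 ((hR i).1.const_mul _), integral_const_mul]
    have h1 := (hQ i).2
    have h2 := mul_le_mul_of_nonneg_left (hR i).2 (by positivity : (0 : ℝ) ≤ (n : ℝ) ^ 2)
    rw [Fintype.card_fin] at h1 h2
    calc _ ≤ _ := add_le_add h1 h2
      _ = _ := by ring
  have hdevm : ∀ i c d e b, Measurable fun ω => dev θ (X i ω) c d e b := by
    intro i c d e b
    have := hX.measurable i
    unfold dev
    fun_prop
  have hZm : Measurable Z := by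
    rw [hZ]
    unfold devSq devDiagSq
    fun_prop
  have hm0 : 0 < m := by
    have h1 : (0 : ℝ) < (n : ℝ) := by exact_mod_cast hn
    have h2 : (0 : ℝ) < ((∑ i, p i : ℕ) : ℝ) := by exact_mod_cast hp
    have := gaussEight_pos
    positivity
  have hZ0 : ∀ ω, 0 ≤ Z ω := by
    intro ω
    rw [hZ]
    simp only [devSq, devDiagSq]
    positivity
  refine ⟨{ω | Z ω ≤ m / η}, measurableSet_le hZm measurable_const, ?_, fun ω h => h⟩
  have hmk := mul_meas_ge_le_integral_of_nonneg (Filter.Eventually.of_forall hZ0) hZi (m / η)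
  have hc : μ.real {ω | Z ω ≤ m / η} = 1 - μ.real {ω | Z ω ≤ m / η}ᶜ := by
    rw [probReal_compl_eq_one_sub (measurableSet_le hZm measurable_const)]
    ring
  have hsub : μ.real {ω | Z ω ≤ m / η}ᶜ ≤ μ.real {ω | m / η ≤ Z ω} := by
    refine measureReal_mono fun ω h => ?_
    simp only [Set.mem_compl_iff, Set.mem_ofPred_eq, not_le] at h ⊢
    exact h.le
  have hle : μ.real {ω | m / η ≤ Z ω} ≤ η := by
    have h1 := hmk.trans hZE
    have h2 : m / η * μ.real {ω | m / η ≤ Z ω} = m * (μ.real {ω | m / η ≤ Z ω} / η) := by ring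
    rw [h2] at h1
    have h3 : μ.real {ω | m / η ≤ Z ω} / η ≤ 1 := by
      refine le_of_mul_le_mul_left ?_ hm0
      linarith
    rwa [div_le_one hη] at h3
  rw [hc]
  linarith

/-! ### Perturbation of the polar step near a signed permutation -/

section Perturbation

variable {n N : ℕ} {p : Fin N → ℕ}

/-- The Lipschitz constant of `meanCorr θ` in the `r`-ball around a signed permutation. -/
noncomputable def lipConst (θ r : ℝ) : ℝ := 3 * θ ^ 2 + 9 * √2 * θ * (1 - θ) * r

/-- The normalized total deviation of the empirical fourth moments. -/
noncomputable def totalDev (θ : ℝ) (X : (i : Fin N) → Matrix (Fin n) (Fin (p i)) ℝ) : ℝ :=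
  (∑ i, √(devSq θ (X i))) / (∑ i, p i : ℕ)

/-- The normalized total deviation of the correlation matrices at the identity. -/
noncomputable def totalDiagDev (θ : ℝ) (X : (i : Fin N) → Matrix (Fin n) (Fin (p i)) ℝ) : ℝ :=
  (∑ i, √(devDiagSq θ (X i))) / (∑ i, p i : ℕ)

lemma totalDev_nonneg (θ : ℝ) (X : (i : Fin N) → Matrix (Fin n) (Fin (p i)) ℝ) :
    0 ≤ totalDev θ X := by unfold totalDev; positivity

lemma totalDiagDev_nonneg (θ : ℝ) (X : (i : Fin N) → Matrix (Fin n) (Fin (p i)) ℝ) :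
    0 ≤ totalDiagDev θ X := by unfold totalDiagDev; positivity

lemma lipConst_nonneg {θ r : ℝ} (hθ : 0 ≤ θ) (hθ1 : θ ≤ 1) (hr : 0 ≤ r) : 0 ≤ lipConst θ r := by
  have : 0 ≤ 1 - θ := by linarith
  unfold lipConst
  positivity

lemma IsSignedPerm.cubeCorr_transpose_mul {P : Matrix (Fin n) (Fin n) ℝ} (hP : IsSignedPerm P)
    {J : Type*} [Fintype J] (W : Matrix (Fin n) (Fin n) ℝ) (X : Matrix (Fin n) J ℝ) :
    cubeCorr (Pᵀ * W) X = Pᵀ * cubeCorr W X := by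
  have h := hP.cubeCorr_mul (Pᵀ * W) X
  rw [← Matrix.mul_assoc, hP.isOrth.mul_transpose, Matrix.one_mul] at h
  rw [h, ← Matrix.mul_assoc, hP.isOrth.transpose_mul, Matrix.one_mul]

lemma norm_transpose_mul_sub_one {P W : Matrix (Fin n) (Fin n) ℝ} (hP : IsOrth P) :
    ‖Pᵀ * W - 1‖ = ‖W - P‖ := by
  rw [← norm_orth_mul _ hP, Matrix.mul_sub, ← Matrix.mul_assoc, hP.mul_transpose, Matrix.one_mul,
    Matrix.mul_one]

/-- After multiplication by `Pᵀ` the ball is centred at `1`. The mean contributes `lipConst`, the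
noise contributes the norm of the tensor `dev`. -/
lemma norm_cubeCorr_sub_cubeCorr_le {P U V : Matrix (Fin n) (Fin n) ℝ} (hP : IsSignedPerm P)
    (hU : IsOrth U) (hV : IsOrth V) {r θ : ℝ} (hr : r ≤ 1) (hUr : ‖U - P‖ ≤ r)
    (hVr : ‖V - P‖ ≤ r) (hθ : 0 ≤ θ) (hθ1 : θ ≤ 1) {J : Type*} [Fintype J]
    (X : Matrix (Fin n) J ℝ) :
    ‖cubeCorr U X - cubeCorr V X‖
      ≤ (Fintype.card J * lipConst θ r + 2 * √(devSq θ X)) * ‖U - V‖ := by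
  have hPt := hP.isOrth.transpose
  rw [← norm_orth_mul (cubeCorr U X - cubeCorr V X) hPt, Matrix.mul_sub,
    ← hP.cubeCorr_transpose_mul, ← hP.cubeCorr_transpose_mul]
  rw [← norm_orth_mul (U - V) hPt, Matrix.mul_sub]
  rw [← norm_transpose_mul_sub_one hP.isOrth] at hUr hVr
  have hU' := hPt.mul hU
  have hV' := hPt.mul hV
  set U' := Pᵀ * U
  set V' := Pᵀ * V
  have e : cubeCorr U' X - cubeCorr V' X
      = ((cubeCorr U' X - (Fintype.card J : ℝ) • meanCorr θ U')
          - (cubeCorr V' X - (Fintype.card J : ℝ) • meanCorr θ V'))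
        + (Fintype.card J : ℝ) • (meanCorr θ U' - meanCorr θ V') := by
    rw [smul_sub]
    abel
  rw [e]
  refine (norm_add_le _ _).trans ?_
  rw [norm_smul, Real.norm_of_nonneg (Nat.cast_nonneg _)]
  have h1 := norm_cubeCorr_dev_sub_le hU' hV' θ X
  have h2 := mul_le_mul_of_nonneg_left (norm_meanCorr_sub_le hU' hV' hr hUr hVr hθ hθ1)
    (Nat.cast_nonneg (Fintype.card J) : (0 : ℝ) ≤ _)
  unfold lipConst
  linarith

lemma norm_cubeCorr_signedPerm_sub {P : Matrix (Fin n) (Fin n) ℝ} (hP : IsSignedPerm P) (θ : ℝ)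
    {J : Type*} [Fintype J] (X : Matrix (Fin n) J ℝ) :
    ‖cubeCorr P X - (Fintype.card J * (3 * θ)) • P‖ = √(devDiagSq θ X) := by
  rw [← norm_cubeCorr_dev_one, meanCorr_one, smul_smul,
    ← norm_orth_mul (cubeCorr 1 X - _) hP.isOrth, Matrix.mul_sub, ← hP.cubeCorr_mul,
    Matrix.mul_smul, Matrix.mul_one]

variable {P : Matrix (Fin n) (Fin n) ℝ} {r θ : ℝ}
  {X : (i : Fin N) → Matrix (Fin n) (Fin (p i)) ℝ} {V : Fin N → Matrix (Fin n) (Fin n) ℝ}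

/-- Comparison with a multiple of an orthogonal matrix is what bounds the smallest singular value
from below. Constant `V` gives the MSP matrix, varying `V` the distributed one. -/
lemma norm_sum_cubeCorr_sub_le (hP : IsSignedPerm P) (hV : ∀ i, IsOrth (V i)) (hr0 : 0 ≤ r)
    (hr : r ≤ 1) (hVr : ∀ i, ‖V i - P‖ ≤ r) (hθ : 0 ≤ θ) (hθ1 : θ ≤ 1) (hp : 0 < ∑ i, p i) :
    ‖∑ i, cubeCorr (V i) (X i) - ((∑ i, p i : ℕ) * (3 * θ)) • P‖
      ≤ (∑ i, p i : ℕ) * (lipConst θ r * r + 2 * totalDev θ X * r + totalDiagDev θ X) := by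
  have hp' : (0 : ℝ) < (∑ i, p i : ℕ) := by exact_mod_cast hp
  have e : ∑ i, cubeCorr (V i) (X i) - ((∑ i, p i : ℕ) * (3 * θ)) • P
      = ∑ i, (cubeCorr (V i) (X i) - ((p i : ℝ) * (3 * θ)) • P) := by
    rw [Finset.sum_sub_distrib, ← Finset.sum_smul, ← Finset.sum_mul]
    push_cast
    rfl
  have h1 : ∀ i, ‖cubeCorr (V i) (X i) - ((p i : ℝ) * (3 * θ)) • P‖
      ≤ p i * (lipConst θ r * r) + √(devSq θ (X i)) * (2 * r) + √(devDiagSq θ (X i)) := by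
    intro i
    have a := norm_cubeCorr_sub_cubeCorr_le hP (hV i) hP.isOrth hr (hVr i) (by simpa) hθ hθ1 (X i)
    have b := norm_cubeCorr_signedPerm_sub hP θ (X i)
    rw [Fintype.card_fin] at a b
    have c : ‖cubeCorr (V i) (X i) - ((p i : ℝ) * (3 * θ)) • P‖ ≤ _ :=
      norm_sub_le_norm_sub_add_norm_sub (cubeCorr (V i) (X i)) (cubeCorr P (X i)) _
    rw [b] at c
    have d : 0 ≤ p i * lipConst θ r + 2 * √(devSq θ (X i)) := by
      have := lipConst_nonneg hθ hθ1 hr0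
      positivity
    have := mul_le_mul_of_nonneg_left (hVr i) d
    linarith
  rw [e]
  refine (norm_sum_le _ _).trans ((Finset.sum_le_sum fun i _ => h1 i).trans (le_of_eq ?_))
  rw [Finset.sum_add_distrib, Finset.sum_add_distrib, ← Finset.sum_mul, ← Finset.sum_mul,
    totalDev, totalDiagDev]
  field_simp
  push_cast
  ring

lemma norm_sum_cubeCorr_sub_sum_le {W : Matrix (Fin n) (Fin n) ℝ} (hP : IsSignedPerm P)
    (hW : IsOrth W) (hV : ∀ i, IsOrth (V i)) (hr0 : 0 ≤ r) (hr : r ≤ 1) (hWr : ‖W - P‖ ≤ r)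
    (hVr : ∀ i, ‖V i - P‖ ≤ r) (hθ : 0 ≤ θ) (hθ1 : θ ≤ 1) (hp : 0 < ∑ i, p i) {d : ℝ}
    (hd : ∀ i, ‖V i - W‖ ≤ d) :
    ‖∑ i, cubeCorr W (X i) - ∑ i, cubeCorr (V i) (X i)‖
      ≤ (∑ i, p i : ℕ) * (lipConst θ r + 2 * totalDev θ X) * d := by
  have hp' : (0 : ℝ) < (∑ i, p i : ℕ) := by exact_mod_cast hp
  rw [← Finset.sum_sub_distrib]
  have h1 : ∀ i, ‖cubeCorr W (X i) - cubeCorr (V i) (X i)‖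
      ≤ (p i * lipConst θ r + 2 * √(devSq θ (X i))) * d := by
    intro i
    have a := norm_cubeCorr_sub_cubeCorr_le hP hW (hV i) hr hWr (hVr i) hθ hθ1 (X i)
    rw [Fintype.card_fin, norm_sub_rev W] at a
    refine a.trans (mul_le_mul_of_nonneg_left (hd i) ?_)
    have := lipConst_nonneg hθ hθ1 hr0
    positivity
  refine (norm_sum_le _ _).trans ((Finset.sum_le_sum fun i _ => h1 i).trans (le_of_eq ?_))
  rw [← Finset.sum_mul, Finset.sum_add_distrib, ← Finset.sum_mul, ← Finset.mul_sum, totalDev]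
  field_simp
  push_cast
  ring

/-- The relative perturbation caused by averaging gradients at different dictionaries. -/
lemma pert_lt {D A : Matrix (Fin n) (Fin n) ℝ} {Ai : Fin N → Matrix (Fin n) (Fin n) ℝ} {α d : ℝ}
    (hn : 0 < n) (hP : IsSignedPerm P) (hA : IsOrth (A * D)) (hAi : ∀ i, IsOrth (Ai i * D))
    (hr : r ≤ 1) (hAr : ‖A * D - P‖ ≤ r) (hAir : ∀ i, ‖Ai i * D - P‖ ≤ r) (hθ : 0 ≤ θ)
    (hθ1 : θ ≤ 1) (hp : 0 < ∑ i, p i) (hd : ∀ i, ‖Ai i * D - A * D‖ ≤ d) (hd0 : 0 < d)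
    (hα : 0 < α)
    (hgap : 2 * (lipConst θ r + 2 * totalDev θ X)
      < 2 * α * (3 * θ - (lipConst θ r * r + 2 * totalDev θ X * r + totalDiagDev θ X))) :
    0 < sigmaMin (cubeCorr (A * D) (concat X)) + sigmaMin (∑ i, cubeCorr (Ai i * D) (X i)) ∧
      pert D X A Ai < α * d := by
  have hp' : (0 : ℝ) < (∑ i, p i : ℕ) := by exact_mod_cast hp
  have hr0 : 0 ≤ r := (norm_nonneg _).trans hAr
  have h1 := norm_sum_cubeCorr_sub_le (X := X) hP (fun _ => hA) hr0 hr (fun _ => hAr) hθ hθ1 hp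
  have h2 := norm_sum_cubeCorr_sub_le (X := X) hP hAi hr0 hr hAir hθ hθ1 hp
  have h3 := norm_sum_cubeCorr_sub_sum_le (X := X) hP hA hAi hr0 hr hAr hAir hθ hθ1 hp hd
  have s1 := sub_le_sigmaMin hn hP.isOrth (by positivity) h1
  have s2 := sub_le_sigmaMin hn hP.isOrth (by positivity) h2
  have hL := lipConst_nonneg hθ hθ1 hr0
  have hT := totalDev_nonneg θ X
  rw [← cubeCorr_concat] at h1 h3 s1
  set e := lipConst θ r * r + 2 * totalDev θ X * r + totalDiagDev θ X
  -- The left side of `hgap` is nonnegative, so the right side must be positive.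
  have he : 0 < 3 * θ - e := by
    by_contra h
    have : 2 * α * (3 * θ - e) ≤ 0 :=
      mul_nonpos_of_nonneg_of_nonpos (by positivity) (not_lt.1 h)
    linarith
  set q : ℝ := ((∑ i, p i : ℕ) : ℝ)
  have hq : 0 < q * (3 * θ - e) := mul_pos hp' he
  have hpos : 0 < sigmaMin (cubeCorr (A * D) (concat X))
      + sigmaMin (∑ i, cubeCorr (Ai i * D) (X i)) := by linarith
  refine ⟨hpos, ?_⟩
  rw [pert, div_lt_iff₀ hpos]
  have h4 : α * d * (2 * (q * (3 * θ - e)))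
      ≤ α * d * (sigmaMin (cubeCorr (A * D) (concat X))
        + sigmaMin (∑ i, cubeCorr (Ai i * D) (X i))) :=
    mul_le_mul_of_nonneg_left (by linarith) (by positivity)
  have h5 : q * d * (2 * (lipConst θ r + 2 * totalDev θ X)) < q * d * (2 * α * (3 * θ - e)) :=
    mul_lt_mul_of_pos_left hgap (by positivity)
  linarith

/-- A ball around a signed permutation is invariant under the MSP step. -/
lemma norm_msp_step_le {W W' : Matrix (Fin n) (Fin n) ℝ} {y : ℝ} (hn : 0 < n)
    (hP : IsSignedPerm P) (hW : IsOrth W) (hy : y ≤ 1) (hWy : ‖W - P‖ ≤ y)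
    (hθ : 0 < θ) (hθ1 : θ ≤ 1) (hp : 0 < ∑ i, p i) (h : IsSVDProj (cubeCorr W (concat X)) W')
    (hgap : (lipConst θ y * y + 2 * totalDev θ X * y + totalDiagDev θ X) * (2 + y)
      ≤ 6 * θ * y) :
    ‖W' - P‖ ≤ y := by
  have hp' : (0 : ℝ) < (∑ i, p i : ℕ) := by exact_mod_cast hp
  have hy0 : 0 ≤ y := (norm_nonneg _).trans hWy
  have h1 := norm_sum_cubeCorr_sub_le (X := X) hP (fun _ => hW) hy0 hy (fun _ => hWy) hθ.le hθ1 hp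
  rw [← cubeCorr_concat] at h1
  have s1 := sub_le_sigmaMin hn hP.isOrth (by positivity) h1
  set q : ℝ := ((∑ i, p i : ℕ) : ℝ)
  -- `P` is its own polar factor up to scale, so the perturbation bound gives `‖W' - P‖ ≤ 2 e / (6 θ
  -- - e)`; `hgap` says that this is at most `y`.
  have h2 : IsSVDProj ((q * (3 * θ)) • P) P := by
    have := (isSVDProj_smul_one (n := n) (c := q * (3 * θ)) (by positivity)).orth_mul_mul_orth
      hP.isOrth isOrth_one
    simpa using this
  have s2 : q * (3 * θ) - 0 ≤ sigmaMin ((q * (3 * θ)) • P) :=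
    sub_le_sigmaMin hn hP.isOrth (by positivity) (by simp)
  have h3 := h.norm_sub_le h2
  set e := lipConst θ y * y + 2 * totalDev θ X * y + totalDiagDev θ X
  have hs : q * (6 * θ - e) ≤ sigmaMin (cubeCorr W (concat X)) + sigmaMin ((q * (3 * θ)) • P) := by
    linarith
  have he : 0 < 6 * θ - e := by nlinarith
  have h4 := mul_le_mul_of_nonneg_right hs (norm_nonneg (W' - P))
  have h5 : q * ((6 * θ - e) * ‖W' - P‖) ≤ q * (2 * e) := by linarith
  have h6 := le_of_mul_le_mul_left h5 hp'
  refine le_of_mul_le_mul_left (h6.trans ?_) he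
  linarith

end Perturbation

/-! ### The constants `epsMax` and `Cconst` -/

section Constants

variable {n : ℕ} {θ α : ℝ}

/-- The denominator of `epsMax`. -/
noncomputable def epsDen (n : ℕ) (θ α : ℝ) : ℝ :=
  2 * α * n * (1 - θ) + 3 * √2 * (1 + α) * (1 - θ) + α * θ

lemma le_sqrt_two : (7 / 5 : ℝ) ≤ √2 := Real.le_sqrt_of_sq_le (by norm_num)

lemma sqrt_two_le : √2 ≤ (3 / 2 : ℝ) := Real.sqrt_le_iff.2 (by norm_num)

/-- In this form the constant is affine in `ε` and vanishes exactly at `epsMax`. -/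
lemma Cconst_eq (n : ℕ) (θ α ε : ℝ) :
    Cconst n θ α ε = 6 * θ * (α - θ - epsDen n θ α * ε) := by
  unfold Cconst epsDen
  ring

variable (hθ : 0 < θ) (hθα : θ < α) (hα : α < 1)
include hθ hθα hα

lemma epsDen_ge (hn : 0 < n) : 10 * α * (1 - θ) + α * θ ≤ epsDen n θ α ∧
    2 * n * (α * (1 - θ)) ≤ epsDen n θ α := by
  have hn1 : (1 : ℝ) ≤ n := by exact_mod_cast hn
  have h1 : 0 < 1 - θ := by linarith
  have hα0 : 0 < α := hθ.trans hθα
  have hs := le_sqrt_two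
  have h2 : 2 * α * (1 - θ) ≤ 2 * α * n * (1 - θ) := by
    have := mul_le_mul_of_nonneg_left hn1 (by positivity : 0 ≤ 2 * α * (1 - θ))
    linarith
  have h3 : (8 * α) * (1 - θ) ≤ 3 * √2 * (1 + α) * (1 - θ) := by
    refine mul_le_mul_of_nonneg_right ?_ h1.le
    nlinarith
  have h4 : 0 ≤ 3 * √2 * (1 + α) * (1 - θ) := by positivity
  have h5 : 0 < α * θ := by positivity
  unfold epsDen
  constructor <;> linarith

lemma epsDen_pos (hn : 0 < n) : 0 < epsDen n θ α := by
  have h := (epsDen_ge hθ hθα hα hn).1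
  have h1 : 0 < 1 - θ := by linarith
  have hα0 : 0 < α := hθ.trans hθα
  have : 0 < 10 * α * (1 - θ) + α * θ := by positivity
  linarith

lemma epsDen_mul_epsMax (hn : 0 < n) : epsDen n θ α * epsMax n θ α = α - θ := by
  have h := (epsDen_pos hθ hθα hα hn).ne'
  unfold epsMax
  rw [← epsDen]
  field_simp

lemma epsMax_le (hn : 0 < n) : epsMax n θ α ≤ 1 / 10 ∧ epsMax n θ α ≤ 1 - θ ∧
    n * epsMax n θ α ≤ 1 / 2 := by
  have h0 := epsDen_pos hθ hθα hα hn
  obtain ⟨h1, h2⟩ := epsDen_ge hθ hθα hα hn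
  have h3 : 0 < 1 - θ := by linarith
  have hα0 : 0 < α := hθ.trans hθα
  have h4 : α - θ ≤ α * (1 - θ) := by nlinarith
  unfold epsMax
  rw [← epsDen]
  refine ⟨?_, ?_, ?_⟩
  · rw [div_le_iff₀ h0]
    nlinarith
  · rw [div_le_iff₀ h0]
    have : α ≤ epsDen n θ α := by nlinarith
    nlinarith
  · rw [← mul_div_assoc, div_le_iff₀ h0]
    have := mul_le_mul_of_nonneg_left h4 (Nat.cast_nonneg n : (0 : ℝ) ≤ n)
    linarith

/-- The right side is the noise-free margin in the hypothesis `hgap` of `pert_lt`. -/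
lemma Cconst_le_gap {r : ℝ} (hr0 : 0 ≤ r) (hr : r ≤ 1) :
    Cconst n θ α r ≤ 2 * α * (3 * θ - lipConst θ r * r) - 2 * lipConst θ r := by
  have h3 : 0 < 1 - θ := by linarith
  have hα0 : 0 < α := hθ.trans hθα
  have e : 2 * α * (3 * θ - lipConst θ r * r) - 2 * lipConst θ r - Cconst n θ α r
      = 12 * α * θ * (1 - θ) * (n * r) + 18 * √2 * α * θ * (1 - θ) * (r * (1 - r)) := by
    unfold lipConst Cconst
    ring
  have : 0 ≤ 12 * α * θ * (1 - θ) * (n * r) + 18 * √2 * α * θ * (1 - θ) * (r * (1 - r)) := by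
    have : 0 ≤ 1 - r := by linarith
    positivity
  linarith

end Constants

/-! ### From the sample size to small deviations -/

section Sample

/-- For `q ≥ 2` this uses `0.69 ^ 4 > 1 / 5`; for `q ≤ 1` the logarithm is `0` and so is the
quotient. -/
lemma natCast_div_log_le (q : ℕ) : (q : ℝ) / Real.log q ^ 4 ≤ 5 * q := by
  rcases lt_or_ge q 2 with hq | hq
  · interval_cases q <;> simp
  · have h2 : Real.log 2 ≤ Real.log q :=
      Real.log_le_log (by norm_num) (by exact_mod_cast hq)
    have h3 : (0.69 : ℝ) ≤ Real.log q := by linarith [Real.log_two_gt_d9]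
    have h4 : (0.69 : ℝ) ^ 4 ≤ Real.log q ^ 4 := pow_le_pow_left₀ (by norm_num) h3 4
    rw [div_le_iff₀ (by positivity)]
    have : (0 : ℝ) ≤ q := Nat.cast_nonneg q
    norm_num at h4
    nlinarith

lemma le_sampleScale {n : ℕ} {θ C δ : ℝ} (hθ : 0 < θ) (hC : 0 < C) (hδ : 0 < δ) :
    4 * (n : ℝ) ^ 2 * θ / (δ ^ 2 * C ^ 2) ≤ sampleScale n θ C δ := by
  unfold sampleScale
  have h1 : 0 ≤ (δ + 2) * (n : ℝ) ^ (5 / 2 : ℝ) / (δ * C) := by positivity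
  have h2 : 4 * (n : ℝ) ^ 2 * θ / (δ ^ 2 * C ^ 2)
      ≤ (δ + 2) ^ 2 * (n : ℝ) ^ 2 * θ / (δ ^ 2 * C ^ 2) := by
    gcongr
    nlinarith
  linarith

/-- The constant in the sample size condition. -/
noncomputable def sampleConst (N : ℕ) (η : ℝ) : ℝ := 3 * 10 ^ 6 * (N + 1) * gaussEight / η

lemma sampleConst_pos (N : ℕ) {η : ℝ} (hη : 0 < η) : 0 < sampleConst N η := by
  have := gaussEight_pos
  unfold sampleConst
  positivity

variable {n N : ℕ} {p : Fin N → ℕ} {θ η C δ : ℝ}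
  {X : (i : Fin N) → Matrix (Fin n) (Fin (p i)) ℝ}

lemma sample_size_ge (hθ : 0 < θ) (hη : 0 < η) (hC : 0 < C) (hδ : 0 < δ) {q : ℕ}
    (h : sampleConst N η * sampleScale n θ C δ ≤ (q : ℝ) / Real.log q ^ 4) :
    2 * 10 ^ 6 * ((N + 1) * (gaussEight * (n ^ 2 * θ))) ≤ η * (q * (δ ^ 2 * C ^ 2)) := by
  have hK := sampleConst_pos N hη
  have hg := gaussEight_pos
  have h1 := (mul_le_mul_of_nonneg_left (le_sampleScale (n := n) hθ hC hδ) hK.le).trans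
    (h.trans (natCast_div_log_le q))
  rw [← mul_div_assoc, div_le_iff₀ (by positivity), sampleConst, div_mul_eq_mul_div,
    div_le_iff₀ hη] at h1
  have h2 : 0 ≤ (N + 1) * (gaussEight * (n ^ 2 * θ)) := by positivity
  linarith

lemma pos_of_sample_size (hn : 0 < n) (hθ : 0 < θ) {q : ℕ}
    (h : 2 * 10 ^ 6 * ((N + 1) * (gaussEight * (n ^ 2 * θ))) ≤ η * (q * (δ ^ 2 * C ^ 2))) :
    0 < q := by
  rw [Nat.pos_iff_ne_zero]
  rintro rfl
  have hg := gaussEight_pos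
  have hn' : (0 : ℝ) < n := by exact_mod_cast hn
  have h0 : 0 < (N + 1) * (gaussEight * (n ^ 2 * θ)) := by positivity
  simp only [Nat.cast_zero, zero_mul, mul_zero] at h
  linarith

lemma sum_sqrt_sq_le {f : Fin N → ℝ} (hf : ∀ i, 0 ≤ f i) :
    (∑ i, √(f i)) ^ 2 ≤ N * ∑ i, f i := by
  have h := sq_sum_le_card_mul_sum_sq (s := Finset.univ) (f := fun i => √(f i))
  simpa [Real.sq_sqrt (hf _)] using h

lemma devSq_nonneg {J : Type*} [Fintype J] (θ : ℝ) (Y : Matrix (Fin n) J ℝ) :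
    0 ≤ devSq θ Y := by unfold devSq; positivity

lemma devDiagSq_nonneg {J : Type*} [Fintype J] (θ : ℝ) (Y : Matrix (Fin n) J ℝ) :
    0 ≤ devDiagSq θ Y := by unfold devDiagSq; positivity

lemma totalDev_le (hn : 0 < n) (hp : 0 < ∑ i, p i) (hθ : 0 < θ) (hη : 0 < η) (hC : 0 < C)
    (hδ : 0 < δ) (hnδ : n * δ ≤ 1 / 2)
    (hE : ∑ i, (devSq θ (X i) + n ^ 2 * devDiagSq θ (X i))
        ≤ 2 * n ^ 4 * (gaussEight * θ) * (∑ i, p i : ℕ) / η)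
    (hK : 2 * 10 ^ 6 * ((N + 1) * (gaussEight * (n ^ 2 * θ)))
      ≤ η * ((∑ i, p i : ℕ) * (δ ^ 2 * C ^ 2))) :
    totalDev θ X ≤ C / 1000 ∧ totalDiagDev θ X ≤ δ * C / 1000 := by
  have hg := gaussEight_pos
  have hn' : (0 : ℝ) < n := by exact_mod_cast hn
  have hp' : (0 : ℝ) < ((∑ i, p i : ℕ) : ℝ) := by exact_mod_cast hp
  have hQ := sum_sqrt_sq_le fun i => devSq_nonneg θ (X i)
  have hR := sum_sqrt_sq_le fun i => devDiagSq_nonneg θ (X i)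
  rw [Finset.sum_add_distrib, ← Finset.mul_sum, le_div_iff₀ hη] at hE
  set q : ℝ := ((∑ i, p i : ℕ) : ℝ)
  have hQ0 : 0 ≤ ∑ i, devSq θ (X i) := Finset.sum_nonneg fun i _ => devSq_nonneg θ (X i)
  have hR0 : 0 ≤ ∑ i, devDiagSq θ (X i) := Finset.sum_nonneg fun i _ => devDiagSq_nonneg θ (X i)
  set Q := ∑ i, devSq θ (X i)
  set R := ∑ i, devDiagSq θ (X i)
  have hN : (0 : ℝ) ≤ N := Nat.cast_nonneg N
  have hR1 : R * η ≤ 2 * n ^ 2 * (gaussEight * θ) * q := by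
    have : (n : ℝ) ^ 2 * (R * η) ≤ n ^ 2 * (2 * n ^ 2 * (gaussEight * θ) * q) := by
      have := mul_nonneg hQ0 hη.le
      linarith
    exact le_of_mul_le_mul_left this (by positivity)
  have hQ1 : Q * η ≤ 2 * n ^ 4 * (gaussEight * θ) * q := by
    have : 0 ≤ (n : ℝ) ^ 2 * R * η := by positivity
    linarith
  have hR2 : N * R * 10 ^ 6 ≤ (q * (δ * C)) ^ 2 := by
    refine le_of_mul_le_mul_left ?_ hη
    calc η * (N * R * 10 ^ 6) = N * 10 ^ 6 * (R * η) := by ring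
      _ ≤ N * 10 ^ 6 * (2 * n ^ 2 * (gaussEight * θ) * q) := by gcongr
      _ ≤ q * (2 * 10 ^ 6 * ((N + 1) * (gaussEight * (n ^ 2 * θ)))) := by
          have : 0 ≤ q * (2 * 10 ^ 6 * (gaussEight * (n ^ 2 * θ))) := by positivity
          linarith
      _ ≤ q * (η * (q * (δ ^ 2 * C ^ 2))) := by gcongr
      _ = _ := by ring
  -- The full tensor costs `n ^ 4`, while the sample size pays only for `n ^ 2 / δ ^ 2`. The missing
  -- factor is supplied by `n δ ≤ 1`.
  have hQ2 : N * Q * 10 ^ 6 ≤ (q * C) ^ 2 := by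
    have hd : (n * δ) ^ 2 ≤ 1 := by
      have : 0 ≤ n * δ := by positivity
      nlinarith
    refine le_of_mul_le_mul_left ?_ (by positivity : 0 < η * δ ^ 2)
    calc η * δ ^ 2 * (N * Q * 10 ^ 6) = N * 10 ^ 6 * δ ^ 2 * (Q * η) := by ring
      _ ≤ N * 10 ^ 6 * δ ^ 2 * (2 * n ^ 4 * (gaussEight * θ) * q) := by gcongr
      _ = q * (2 * 10 ^ 6 * (N * (gaussEight * (n ^ 2 * θ)))) * (n * δ) ^ 2 := by ring
      _ ≤ q * (2 * 10 ^ 6 * (N * (gaussEight * (n ^ 2 * θ)))) * 1 := by gcongr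
      _ ≤ q * (2 * 10 ^ 6 * ((N + 1) * (gaussEight * (n ^ 2 * θ)))) := by
          have : 0 ≤ q * (2 * 10 ^ 6 * (gaussEight * (n ^ 2 * θ))) := by positivity
          linarith
      _ ≤ q * (η * (q * (δ ^ 2 * C ^ 2))) := by gcongr
      _ = _ := by ring
  constructor
  · rw [totalDev, div_le_iff₀ hp']
    refine abs_le_of_sq_le_sq' ?_ (by positivity) |>.2
    refine hQ.trans ?_
    have e : (C / 1000 * q) ^ 2 = (q * C) ^ 2 / 10 ^ 6 := by ring
    rw [e, le_div_iff₀ (by norm_num)]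
    exact hQ2
  · rw [totalDiagDev, div_le_iff₀ hp']
    refine abs_le_of_sq_le_sq' ?_ (by positivity) |>.2
    refine hR.trans ?_
    have e : (δ * C / 1000 * q) ^ 2 = (q * (δ * C)) ^ 2 / 10 ^ 6 := by ring
    rw [e, le_div_iff₀ (by norm_num)]
    exact hR2

end Sample

/-! ### Runs of the two algorithms and the induction -/

section Runs

variable {n N : ℕ} {p : Fin N → ℕ} {D : Matrix (Fin n) (Fin n) ℝ}

lemma cubeCorr_orth_mul {J : Type*} [Fintype J] (A : Matrix (Fin n) (Fin n) ℝ)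
    (X : Matrix (Fin n) J ℝ) : cubeCorr A (D * X) = cubeCorr (A * D) X * Dᵀ := by
  simp only [cubeCorr, Matrix.transpose_mul, Matrix.mul_assoc]

lemma IsSVDProj.mul_of_smul_mul_transpose (hD : IsOrth D) {M Q : Matrix (Fin n) (Fin n) ℝ}
    {c : ℝ} (hc : 0 < c) (h : IsSVDProj (c • (M * Dᵀ)) Q) : IsSVDProj M (Q * D) := by
  have := (h.of_smul hc).orth_mul_mul_orth isOrth_one hD
  rwa [Matrix.one_mul, Matrix.one_mul, Matrix.mul_assoc, hD.transpose_mul, Matrix.mul_one] at this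

lemma IsMSP.step_mul (hD : IsOrth D) {J : Type*} [Fintype J] {X : Matrix (Fin n) J ℝ}
    {A : ℕ → Matrix (Fin n) (Fin n) ℝ} (h : IsMSP (D * X) A) (k : ℕ) :
    IsSVDProj (cubeCorr (A k * D) X) (A (k + 1) * D) := by
  have := h.step k
  rw [grad, cubeCorr_orth_mul] at this
  exact this.mul_of_smul_mul_transpose hD (by norm_num)

lemma IsMSP.isOrth {J : Type*} [Fintype J] {Y : Matrix (Fin n) J ℝ}
    {A : ℕ → Matrix (Fin n) (Fin n) ℝ} (h : IsMSP Y A) : ∀ k, IsOrth (A k)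
  | 0 => h.init
  | k + 1 => (h.step k).isOrth

lemma IsDMSP.isOrth {W : ℕ → ℕ → Matrix (Fin N) (Fin N) ℝ} {Tc : ℕ → ℕ}
    {Y : (i : Fin N) → Matrix (Fin n) (Fin (p i)) ℝ} {A : ℕ → Fin N → Matrix (Fin n) (Fin n) ℝ}
    (h : IsDMSP W Tc Y A) : ∀ k i, IsOrth (A k i)
  | 0, i => h.init i
  | k + 1, i => (h.step k i).isOrth

lemma IsPerfectConsensus.step_mul (hD : IsOrth D) (hN : 0 < N)
    {X : (i : Fin N) → Matrix (Fin n) (Fin (p i)) ℝ}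
    {A : ℕ → Fin N → Matrix (Fin n) (Fin n) ℝ} {Abar : ℕ → Matrix (Fin n) (Fin n) ℝ}
    (h : IsPerfectConsensus (fun i => D * X i) A Abar) (k : ℕ) :
    IsSVDProj (∑ i, cubeCorr (A k i * D) (X i)) (Abar (k + 1) * D) := by
  have h1 := h k
  have hN' : (0 : ℝ) < N := by exact_mod_cast hN
  simp only [grad, cubeCorr_orth_mul] at h1
  rw [← Finset.smul_sum, ← Finset.sum_mul, smul_smul] at h1
  exact h1.mul_of_smul_mul_transpose hD (by positivity)

lemma norm_sub_le_maxDev (M : Matrix (Fin n) (Fin n) ℝ) (A : Fin N → Matrix (Fin n) (Fin n) ℝ)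
    (i : Fin N) : ‖A i - M‖ ≤ maxDev M A :=
  le_ciSup (f := fun i => ‖A i - M‖) (Set.finite_range _).bddAbove i

lemma exists_eq_maxDev (hN : 0 < N) (M : Matrix (Fin n) (Fin n) ℝ)
    (A : Fin N → Matrix (Fin n) (Fin n) ℝ) : ∃ i, ‖A i - M‖ = maxDev M A := by
  have : Nonempty (Fin N) := ⟨⟨0, hN⟩⟩
  exact exists_eq_ciSup_of_finite

/-- For `n = 0` all matrices agree, and for `N = 0` the real supremum over the empty family is `0`.
-/
lemma pos_of_maxDev_pos {M : Matrix (Fin n) (Fin n) ℝ} {A : Fin N → Matrix (Fin n) (Fin n) ℝ}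
    (h : 0 < maxDev M A) : 0 < n ∧ 0 < N := by
  constructor <;> rw [Nat.pos_iff_ne_zero] <;> rintro rfl
  · have : ∀ i, A i - M = 0 := fun i => Subsingleton.elim _ _
    simp [maxDev, this] at h
  · simp [maxDev] at h

lemma norm_mul_sub_eq (hD : IsOrth D) (A P : Matrix (Fin n) (Fin n) ℝ) :
    ‖A * D - P‖ = ‖A - P * Dᵀ‖ := by
  rw [← norm_mul_orth (A - P * Dᵀ) hD, Matrix.sub_mul, Matrix.mul_assoc, hD.transpose_mul,
    Matrix.mul_one]

variable {θ α ε : ℝ} {X : (i : Fin N) → Matrix (Fin n) (Fin (p i)) ℝ}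
  {P : Matrix (Fin n) (Fin n) ℝ}

lemma Cconst_eq_epsDen (hθ : 0 < θ) (hθα : θ < α) (hα : α < 1) (hn : 0 < n) (r : ℝ) :
    Cconst n θ α r = 6 * θ * (epsDen n θ α * (epsMax n θ α - r)) := by
  rw [Cconst_eq, ← epsDen_mul_epsMax hθ hθα hα hn]
  ring

lemma Cconst_pos (hθ : 0 < θ) (hθα : θ < α) (hα : α < 1) (hn : 0 < n)
    (hε : ε < epsMax n θ α) : 0 < Cconst n θ α ε := by
  rw [Cconst_eq_epsDen hθ hθα hα hn]
  have := epsDen_pos hθ hθα hα hn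
  have : 0 < epsMax n θ α - ε := sub_pos.2 hε
  positivity

/-- One step of the comparison of DMSP with MSP near a signed permutation. -/
lemma maxDev_succ_lt (hn : 0 < n) (hN : 0 < N) (hp : 0 < ∑ i, p i) (hθ : 0 < θ) (hθα : θ < α)
    (hα : α < 1) (hε0 : 0 ≤ ε) (hε : ε < epsMax n θ α) (hD : IsOrth D) (hP : IsSignedPerm P)
    {A A' : Matrix (Fin n) (Fin n) ℝ} {Ai Ai' : Fin N → Matrix (Fin n) (Fin n) ℝ}
    {Abar : Matrix (Fin n) (Fin n) ℝ} (hA : IsOrth A) (hAi : ∀ i, IsOrth (Ai i))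
    (hA' : IsSVDProj (cubeCorr (A * D) (concat X)) (A' * D))
    (hAbar : IsSVDProj (∑ i, cubeCorr (Ai i * D) (X i)) (Abar * D))
    (hAP : ‖A * D - P‖ ≤ (ε + epsMax n θ α) / 2)
    (hAiP : ∀ i, ‖Ai i * D - P‖ ≤ (ε + epsMax n θ α) / 2)
    (hτ : totalDev θ X ≤ Cconst n θ α ε / 1000) (hs : totalDiagDev θ X ≤ Cconst n θ α ε / 1000)
    (hδ : 0 < maxDev A Ai)
    (hc : (Set.Ico 0 (α * maxDev A Ai - pert D X A Ai)).Nonempty →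
      maxDev Abar Ai' ∈ Set.Ico 0 (α * maxDev A Ai - pert D X A Ai)) :
    maxDev A' Ai' < α * maxDev A Ai := by
  have hα0 : 0 < α := hθ.trans hθα
  have hC := Cconst_pos hθ hθα hα hn hε
  have hmax := (epsMax_le hθ hθα hα hn).1
  have hd : ∀ i, ‖Ai i * D - A * D‖ ≤ maxDev A Ai := fun i => by
    rw [← Matrix.sub_mul, norm_mul_orth _ hD]
    exact norm_sub_le_maxDev A Ai i
  -- Affine and zero at `epsMax`, the constant is halved at the midpoint: the ball can be enlarged
  -- beyond `ε` with half of the margin left for noise.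
  have hC2 : Cconst n θ α ((ε + epsMax n θ α) / 2) = Cconst n θ α ε / 2 := by
    rw [Cconst_eq_epsDen hθ hθα hα hn, Cconst_eq_epsDen hθ hθα hα hn]
    ring
  set r := (ε + epsMax n θ α) / 2 with hr
  have hr0 : 0 ≤ r := by linarith
  have hr1 : r ≤ 1 := by linarith
  have hgap0 := Cconst_le_gap (n := n) hθ hθα hα hr0 hr1
  have hT := totalDev_nonneg θ X
  have hS := totalDiagDev_nonneg θ X
  have hgap : 2 * (lipConst θ r + 2 * totalDev θ X)
      < 2 * α * (3 * θ - (lipConst θ r * r + 2 * totalDev θ X * r + totalDiagDev θ X)) := by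
    have h1 : α * (totalDev θ X * r) ≤ totalDev θ X := by
      have : α * r ≤ 1 := by nlinarith
      nlinarith
    have h2 : α * totalDiagDev θ X ≤ totalDiagDev θ X := by nlinarith
    linarith
  obtain ⟨hσ, hρ⟩ := pert_lt hn hP (hA.mul hD) (fun i => (hAi i).mul hD) hr1 hAP hAiP hθ.le
    (hθα.trans hα).le hp hd hδ hα0 hgap
  -- `ρ < α δ` makes the interval non-empty, which activates the consensus hypothesis.
  obtain ⟨-, hδc⟩ := hc ⟨0, le_rfl, sub_pos.2 hρ⟩
  have hpolar := hA'.norm_sub_le hAbar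
  rw [← Matrix.sub_mul, norm_mul_orth _ hD] at hpolar
  have hAA : ‖A' - Abar‖ ≤ pert D X A Ai := by
    rw [pert, le_div_iff₀ hσ, mul_comm]
    exact hpolar
  obtain ⟨i, hi⟩ := exists_eq_maxDev hN A' Ai'
  rw [← hi]
  have h1 := norm_sub_le_norm_sub_add_norm_sub (Ai' i) Abar A'
  rw [norm_sub_rev Abar A'] at h1
  have h2 := norm_sub_le_maxDev Abar Ai' i
  linarith

/-- Provides the invariance condition of `norm_msp_step_le`. Each error term must be a small
multiple of `θ (1 - θ) y`, since the margin degenerates as `θ` tends to `1` or `y` to `0`. -/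
lemma msp_gap {y τ s δ : ℝ} (hn : 0 < n) (hθ : 0 < θ) (hθα : θ < α) (hα : α < 1)
    (hε0 : 0 ≤ ε) (hε : ε < epsMax n θ α) (hδ : δ ≤ ε)
    (hy : epsMax n θ α - ε ≤ 2 * y) (hymax : y ≤ epsMax n θ α)
    (hτ : τ ≤ Cconst n θ α ε / 1000) (hs : s ≤ δ * Cconst n θ α ε / 1000) :
    (lipConst θ y * y + 2 * τ * y + s) * (2 + y) ≤ 6 * θ * y := by
  obtain ⟨hm1, hm2, -⟩ := epsMax_le hθ hθα hα hn
  have hden := epsDen_pos hθ hθα hα hn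
  have hprod := epsDen_mul_epsMax hθ hθα hα hn
  have hy0 : 0 < y := by linarith
  have hm : 0 < 1 - θ := by linarith
  have hC := Cconst_pos hθ hθα hα hn hε
  have hC1 : Cconst n θ α ε ≤ 6 * θ * (1 - θ) := by
    rw [Cconst_eq]
    refine mul_le_mul_of_nonneg_left ?_ (by positivity)
    have : 0 ≤ epsDen n θ α * ε := by positivity
    linarith
  -- The constant is proportional to `epsMax - ε ≤ 2 y`, and the factor `δ` absorbs `epsDen`, which
  -- may grow with `n`.
  have hδC : δ * Cconst n θ α ε ≤ 12 * (θ * ((1 - θ) * y)) := by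
    rw [Cconst_eq_epsDen hθ hθα hα hn]
    have h1 : epsDen n θ α * δ ≤ 1 - θ := by
      have := mul_le_mul_of_nonneg_left (hδ.trans hε.le) hden.le
      linarith
    have h2 : 0 ≤ epsMax n θ α - ε := by linarith
    calc δ * (6 * θ * (epsDen n θ α * (epsMax n θ α - ε)))
        = 6 * θ * ((epsDen n θ α * δ) * (epsMax n θ α - ε)) := by ring
      _ ≤ 6 * θ * ((1 - θ) * (2 * y)) := by gcongr
      _ = _ := by ring
  have hL : lipConst θ y ≤ θ * (3 * θ + 1.35 * (1 - θ)) := by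
    have h1 : √2 * y ≤ 3 / 2 * (1 / 10) := by
      have := sqrt_two_le
      gcongr
      linarith
    have h2 : 9 * √2 * θ * (1 - θ) * y = 9 * (θ * (1 - θ)) * (√2 * y) := by ring
    have h3 := mul_le_mul_of_nonneg_left h1 (by positivity : 0 ≤ 9 * (θ * (1 - θ)))
    unfold lipConst
    rw [h2]
    linarith
  have hτy : 2 * τ * y ≤ 0.012 * (θ * ((1 - θ) * y)) := by
    have : τ * y ≤ 6 * θ * (1 - θ) / 1000 * y :=
      mul_le_mul_of_nonneg_right (by linarith) hy0.le
    linarith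
  have hLy := mul_le_mul_of_nonneg_right hL hy0.le
  have hsum : lipConst θ y * y + 2 * τ * y + s ≤ θ * y * (3 - 1.6 * (1 - θ)) := by
    have : 0 ≤ θ * ((1 - θ) * y) := by positivity
    linarith
  -- Here `y ≤ epsMax ≤ 1 - θ` is essential: the growth `3 y` is absorbed by `3.2 (1 - θ)`.
  have hfin : (3 - 1.6 * (1 - θ)) * (2 + y) ≤ 6 := by
    have : 0 ≤ (1 - θ) * y := by positivity
    linarith
  calc _ ≤ θ * y * (3 - 1.6 * (1 - θ)) * (2 + y) :=
        mul_le_mul_of_nonneg_right hsum (by linarith)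
    _ = θ * y * ((3 - 1.6 * (1 - θ)) * (2 + y)) := by ring
    _ ≤ θ * y * 6 := by gcongr
    _ = _ := by ring

/-- Initialization: the deviation of the local dictionaries and the distance of the MSP iterate
from the signed permutation fit into the `ε`-ball. -/
lemma norm_sub_le_of_l4pow4_ge {d : ℝ} {W : Matrix (Fin n) (Fin n) ℝ} (hW : IsOrth W)
    (hP : IsSignedPerm P) (hε : ε ≤ 1 / 2) (hWP : ‖W - P‖ ≤ ε) (hd : d ≤ ‖W - P‖ + ε)
    (hl : (n : ℝ) - 1 / 2 * (ε - d) ^ 2 ≤ l4pow4 W) : d ≤ ε ∧ ‖W - P‖ ≤ ε - d := by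
  have h1 : ‖W - P‖ ^ 2 ≤ n - l4pow4 W := by
    have h := norm_sub_one_sq_le_l4 (U := Pᵀ * W) (hP.isOrth.transpose.mul hW)
      (by rw [norm_transpose_mul_sub_one hP.isOrth]; linarith)
    rw [norm_transpose_mul_sub_one hP.isOrth] at h
    have h2 := hP.l4pow4_mul (Pᵀ * W)
    rw [← Matrix.mul_assoc, hP.isOrth.mul_transpose, Matrix.one_mul] at h2
    rwa [h2]
  have hx := norm_nonneg (W - P)
  have hd' : d ≤ ε := by
    -- If `d > ε`, then `0 < d - ε ≤ ‖W - P‖`, while the fourth-power bound gives `‖W - P‖² ≤ (d -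
    -- ε)² / 2`.
    by_contra h
    push Not at h
    nlinarith
  refine ⟨hd', ?_⟩
  refine abs_le_of_sq_le_sq' ?_ (by linarith) |>.2
  nlinarith [sq_nonneg (ε - d)]

/-- Linear convergence on the event that the empirical fourth moments are accurate. -/
lemma maxDev_lt_of_totalDev_le (hp : 0 < ∑ i, p i) (hθ : 0 < θ)
    (hθα : θ < α) (hα : α < 1) (hε0 : 0 ≤ ε) (hε : ε < epsMax n θ α) (hD : IsOrth D)
    (hP : IsSignedPerm P) {A : ℕ → Matrix (Fin n) (Fin n) ℝ}
    {Ai : ℕ → Fin N → Matrix (Fin n) (Fin n) ℝ} {Abar : ℕ → Matrix (Fin n) (Fin n) ℝ}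
    (hA : ∀ k, IsOrth (A k)) (hAi : ∀ k i, IsOrth (Ai k i))
    (hA' : ∀ k, IsSVDProj (cubeCorr (A k * D) (concat X)) (A (k + 1) * D))
    (hAbar : ∀ k, IsSVDProj (∑ i, cubeCorr (Ai k i * D) (X i)) (Abar (k + 1) * D)) (t : ℕ)
    (hδ : ∀ k, t ≤ k → 0 < maxDev (A k) (Ai k))
    (hδε : maxDev (A t) (Ai t) ≤ ε) (hAt : ‖A t * D - P‖ ≤ ε - maxDev (A t) (Ai t))
    (hc : ∀ k, t ≤ k →
      (Set.Ico 0 (α * maxDev (A k) (Ai k) - pert D X (A k) (Ai k))).Nonempty →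
      maxDev (Abar (k + 1)) (Ai (k + 1))
        ∈ Set.Ico 0 (α * maxDev (A k) (Ai k) - pert D X (A k) (Ai k)))
    (hτ : totalDev θ X ≤ Cconst n θ α ε / 1000)
    (hs : totalDiagDev θ X ≤ maxDev (A t) (Ai t) * Cconst n θ α ε / 1000) :
    ∀ k, t ≤ k → maxDev (A (k + 1)) (Ai (k + 1)) < α * maxDev (A k) (Ai k) := by
  obtain ⟨hn, hN⟩ := pos_of_maxDev_pos (hδ t le_rfl)
  have hC := Cconst_pos hθ hθα hα hn hε
  have hmax := (epsMax_le hθ hθα hα hn).1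
  -- MSP is confined to the `y`-ball, so local dictionaries within the initial deviation of it stay
  -- in the ball of radius `(ε + epsMax) / 2`. As that deviation is at most `ε`, `y` is at least
  -- `(epsMax - ε) / 2`.
  set y := (ε + epsMax n θ α) / 2 - maxDev (A t) (Ai t) with hy
  have hδt := hδ t le_rfl
  have hgap := msp_gap hn hθ hθα hα hε0 hε hδε (y := y) (by linarith) (by linarith) hτ hs
  have hs' : totalDiagDev θ X ≤ Cconst n θ α ε / 1000 := by nlinarith
  have hstep : ∀ k, t ≤ k → ‖A k * D - P‖ ≤ y → maxDev (A k) (Ai k) ≤ maxDev (A t) (Ai t) →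
      maxDev (A (k + 1)) (Ai (k + 1)) < α * maxDev (A k) (Ai k) := by
    intro k hk hAk hδk
    refine maxDev_succ_lt hn hN hp hθ hθα hα hε0 hε hD hP (hA k) (hAi k) (hA' k) (hAbar k)
      (by linarith) (fun i => ?_) hτ hs' (hδ k hk) (hc k hk)
    have h1 := norm_sub_le_norm_sub_add_norm_sub (Ai k i * D) (A k * D) P
    rw [← Matrix.sub_mul, norm_mul_orth _ hD] at h1
    have h2 := norm_sub_le_maxDev (A k) (Ai k) i
    linarith
  have hinv : ∀ k, t ≤ k →
      ‖A k * D - P‖ ≤ y ∧ maxDev (A k) (Ai k) ≤ maxDev (A t) (Ai t) := by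
    intro k hk
    induction k, hk using Nat.le_induction with
    | base => exact ⟨by linarith, le_rfl⟩
    | succ k hk ih =>
      refine ⟨norm_msp_step_le hn hP ((hA k).mul hD) (by linarith) ih.1 hθ (hθα.trans hα).le hp
        (hA' k) hgap, ?_⟩
      have h1 := hstep k hk ih.1 ih.2
      have h2 := hδ k hk
      have h3 := ih.2
      nlinarith
  exact fun k hk => hstep k hk (hinv k hk).1 (hinv k hk).2

end Runs

end DMSP

/-! ### The main theorem -/

theorem theorem6 (N : ℕ) (η : ℝ) (hη : 0 < η) :
    ∃ K : ℝ, 0 < K ∧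
    ∀ (n : ℕ) (θ α ε : ℝ), 0 < θ → θ < α → α < 1 → 0 ≤ ε → ε < DMSP.epsMax n θ α →
    ∀ (p : Fin N → ℕ) (D : Matrix (Fin n) (Fin n) ℝ), DMSP.IsOrth D →
    ∀ (Ω : Type*) [MeasurableSpace Ω] (μ : Measure Ω) [IsProbabilityMeasure μ]
      (X : (i : Fin N) → Ω → Matrix (Fin n) (Fin (p i)) ℝ), DMSP.IsBGData μ θ X →
    ∀ (E : ℕ → ℕ → Fin N → Fin N → Prop) (W : ℕ → ℕ → Matrix (Fin N) (Fin N) ℝ),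
      DMSP.UniformlyStronglyConnected E → DMSP.IsWeights E W →
    ∀ (Tc : ℕ → Ω → ℕ)
      (A : ℕ → Ω → Matrix (Fin n) (Fin n) ℝ)
      (Aloc : ℕ → Ω → Fin N → Matrix (Fin n) (Fin n) ℝ)
      (Abar : ℕ → Ω → Matrix (Fin n) (Fin n) ℝ),
      (∀ ω, DMSP.IsMSP (D * DMSP.concat fun i => X i ω) fun k => A k ω) →
      (∀ ω, DMSP.IsDMSP W (fun k => Tc k ω) (fun i => D * X i ω) fun k => Aloc k ω) →
      (∀ ω, DMSP.IsPerfectConsensus (fun i => D * X i ω) (fun k => Aloc k ω)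
        fun k => Abar k ω) →
    ∀ (δ δc ρ : ℕ → Ω → ℝ),
      (∀ k ω, δ k ω = DMSP.maxDev (A k ω) (Aloc k ω)) →
      (∀ k ω, δc k ω = DMSP.maxDev (Abar k ω) (Aloc k ω)) →
      (∀ k ω, ρ k ω = DMSP.pert D (fun i => X i ω) (A k ω) (Aloc k ω)) →
    ∀ t : ℕ,
    ∃ G : Set Ω, MeasurableSet G ∧ 1 - η ≤ μ.real G ∧ ∀ ω ∈ G,
      (∃ P : Matrix (Fin n) (Fin n) ℝ, DMSP.IsSignedPerm P ∧
        ‖A t ω - P * Dᵀ‖ ≤ ε ∧ ∀ i, ‖Aloc t ω i - P * Dᵀ‖ ≤ ε) →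
      (n : ℝ) - 1 / 2 * (ε - δ t ω) ^ 2 ≤ DMSP.l4pow4 (A t ω * D) →
      (∀ k, t ≤ k → 0 < δ k ω) →
      (∀ k, t ≤ k → (Set.Ico 0 (α * δ k ω - ρ k ω)).Nonempty →
        δc (k + 1) ω ∈ Set.Ico 0 (α * δ k ω - ρ k ω)) →
      K * DMSP.sampleScale n θ (DMSP.Cconst n θ α ε) (δ t ω)
          ≤ ((∑ i, p i : ℕ) : ℝ) / Real.log ((∑ i, p i : ℕ) : ℝ) ^ 4 →
      ∀ k, t ≤ k → δ (k + 1) ω < α * δ k ω := by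
  classical
  refine ⟨DMSP.sampleConst N η, DMSP.sampleConst_pos N hη, ?_⟩
  intro n θ α ε hθ hθα hα hε0 hε p D hD Ω _ μ _ X hX E W _ _ Tc A Aloc Abar hMSP hDMSP hbar
    δ δc ρ hδ hδc hρ t
  -- With no rows or no samples the hypotheses of the implication are contradictory, so the whole
  -- space serves as the event.
  by_cases hdeg : 0 < n ∧ 0 < ∑ i, p i
  · obtain ⟨hn, hp⟩ := hdeg
    obtain ⟨G, hGm, hGp, hG⟩ := DMSP.exists_event hX hθ hη hn hp
    refine ⟨G, hGm, hGp, fun ω hω ⟨P, hP, hAP, hAlocP⟩ hl hpos hc hK => ?_⟩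
    simp only [hδ, hδc, hρ] at hl hpos hc hK ⊢
    have hC := DMSP.Cconst_pos hθ hθα hα hn hε
    obtain ⟨hm1, -, hm3⟩ := DMSP.epsMax_le hθ hθα hα hn
    have hN := (DMSP.pos_of_maxDev_pos (hpos t le_rfl)).2
    have hAt := (hMSP ω).isOrth t
    rw [← DMSP.norm_mul_sub_eq hD] at hAP
    obtain ⟨i, hi⟩ := DMSP.exists_eq_maxDev hN (A t ω) (Aloc t ω)
    have hdev : DMSP.maxDev (A t ω) (Aloc t ω) ≤ ‖A t ω * D - P‖ + ε := by
      have h1 := norm_sub_le_norm_sub_add_norm_sub (Aloc t ω i) (P * Dᵀ) (A t ω)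
      rw [norm_sub_rev (P * Dᵀ), ← DMSP.norm_mul_sub_eq hD (A t ω), hi] at h1
      linarith [hAlocP i]
    obtain ⟨hle, hAtP⟩ := DMSP.norm_sub_le_of_l4pow4_ge (DMSP.IsOrth.mul hAt hD) hP (by linarith)
      hAP hdev hl
    have hnδ : n * DMSP.maxDev (A t ω) (Aloc t ω) ≤ 1 / 2 :=
      (mul_le_mul_of_nonneg_left (hle.trans hε.le) (Nat.cast_nonneg n)).trans hm3
    obtain ⟨hτ, hs⟩ := DMSP.totalDev_le hn hp hθ hη hC (hpos t le_rfl) hnδ (hG ω hω)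
      (DMSP.sample_size_ge hθ hη hC (hpos t le_rfl) hK)
    exact DMSP.maxDev_lt_of_totalDev_le (X := fun i => X i ω) (A := fun k => A k ω)
      (Ai := fun k => Aloc k ω) (Abar := fun k => Abar k ω) hp hθ hθα hα hε0 hε hD hP (hMSP ω).isOrth
      (hDMSP ω).isOrth (fun k => (hMSP ω).step_mul hD k) (fun k => (hbar ω).step_mul hD hN k) t
      hpos hle hAtP hc hτ hs
  · refine ⟨Set.univ, MeasurableSet.univ, by simpa using hη.le, fun ω _ _ _ hpos _ hK => ?_⟩
    exfalso
    have hδt := hpos t le_rfl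
    have hδt' := hδt
    rw [hδ] at hδt'
    have hn := (DMSP.pos_of_maxDev_pos hδt').1
    have hp := DMSP.pos_of_sample_size hn hθ
      (DMSP.sample_size_ge hθ hη (DMSP.Cconst_pos hθ hθα hα hn hε) hδt hK)
    exact hdeg ⟨hn, hp⟩
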